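/- Let $n\ge 1$ be an integer and $\beta>n/2$, and let $\phi_\beta(x)=(1+|x|^2)^{-\beta}$, $x\in\mathbb R^n$. For $f\in L^2(\mathbb R^n)$ let $\widehat f$ denote its Fourier transform, normalized by $\widehat f(\xi)=\int_{\mathbb R^n}e^{-i\xi\cdot x}f(x)\,dx$ and extended to $L^2$ by Plancherel. Let $K_\alpha$ be the modified Bessel function of the second kind of order $\alpha$, let $B$ be the Beta function, and put $$G_\beta(\xi)=\frac{1}{2^{\beta-1+\frac n2}\,\pi^{\frac n2}\,\Gamma(\beta)}\,K_{\beta-\frac n2}(|\xi|)\,|\xi|^{\beta-\frac n2}.$$ For $\alpha>0$ let $\mathcal K_\alpha(\mathbb R^n)$ be the space of all continuous $f:\mathbb R^n\to\mathbb C$ in $L^2(\mathbb R^n)$ with $$\int_{\mathbb R^n}\frac{|\widehat f(\xi)|^2}{K_\alpha(|\xi|)\,|\xi|^\alpha}\,d\xi<\infty .$$ (i) The Hilbert space of functions on $\mathbb R^n$ with the reproducing kernel $\phi_\beta(x-y)$ coincides with $\mathcal K_{\beta-n/2}(\mathbb R^n)$, equipped with the inner product $$(f,g)=(2\pi)^{-2n}\int_{\mathbb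 R^n}\frac{\widehat f(\xi)\,\overline{\widehat g(\xi)}}{G_\beta(\xi)}\,d\xi ,$$ the integral being absolutely convergent. That is, $\mathcal K_{\beta-n/2}(\mathbb R^n)$ with this inner product is a Hilbert space of functions with reproducing kernel $\phi_\beta(x-y)$, and every Hilbert space of complex-valued functions on $\mathbb R^n$ with this reproducing kernel consists of the same functions and has the same inner product. (ii) Let $X=\{x_j\}_{j\in\mathbb N}\subset\mathbb R^n$ satisfy $\delta(X)=\inf_{j\ne k}|x_j-x_k|>0$. If $n\ge 2$, or if $n=1$ and $\delta(X)>2B\!\left(\beta-\tfrac12,\tfrac12\right)$, then the functions $\phi_\beta(\cdot-x_j)$, $j\in\mathbb N$, belong to $\mathcal K_{\beta-n/2}(\mathbb R^n)$ and form a Riesz sequence there, that is, $$\Big\{\big((f,\phi_\beta(\cdot-x_j))\big)_{j\in\mathbb N}:f\in\mathcal K_{\beta-n/2}(\mathbb R^n)\Big\}=\ell^2(\mathbb N).$$ -/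

import Mathlib

open MeasureTheory FourierTransform InnerProductSpace
open scoped ENNReal ComplexConjugate

namespace Multiquadric

noncomputable section

/-- The Euclidean space `ℝⁿ`. -/
abbrev E (n : ℕ) : Type := EuclideanSpace ℝ (Fin n)

/-! ### The modified Bessel function of the second kind -/

/-- The modified Bessel function of the second kind of real order `a`, for `z > 0`, through
Schläfli's integral `K_a(z) = ½ ∫_ℝ exp(-z cosh t - a t) dt` (absolutely convergent for `z > 0`). -/
def besselK (a z : ℝ) : ℝ :=
  (1 / 2) * ∫ t : ℝ, Real.exp (-z * Real.cosh t - a * t)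

/-- The Matérn function `K_a(z) z^a`, for `z > 0`. -/
def matern (a z : ℝ) : ℝ := besselK a z * z ^ a

/-- The Bessel potential kernel
`G_b(z) = K_{b-n/2}(z) z^{b-n/2} / (2^{b-1+n/2} π^{n/2} Γ(b))`. -/
def besselPotential (n : ℕ) (b z : ℝ) : ℝ :=
  1 / ((2 : ℝ) ^ (b - 1 + (n : ℝ) / 2) * Real.pi ^ ((n : ℝ) / 2) * Real.Gamma b)
    * (besselK (b - (n : ℝ) / 2) z * z ^ (b - (n : ℝ) / 2))

/-- The inverse multi-quadric `φ_b(x) = (1 + |x|²)^{-b}`. -/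
def invMultiquadric (n : ℕ) (b : ℝ) (x : E n) : ℂ := (((1 + ‖x‖ ^ 2) ^ (-b) : ℝ) : ℂ)

lemma besselK_nonneg (a z : ℝ) : 0 ≤ besselK a z :=
  mul_nonneg (by norm_num) (integral_nonneg fun _ => (Real.exp_pos _).le)

lemma integrable_besselK (a : ℝ) {z : ℝ} (hz : 0 < z) :
    Integrable fun t : ℝ => Real.exp (-z * Real.cosh t - a * t) := by
  have h1 : Integrable fun t : ℝ =>
      Real.exp (2 * a ^ 2 / z) * Real.exp (-(z / 8) * t ^ 2) :=
    (integrable_exp_neg_mul_sq (by positivity)).const_mul _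
  refine h1.mono' (by fun_prop) (Filter.Eventually.of_forall fun t => ?_)
  rw [Real.norm_of_nonneg (Real.exp_pos _).le, ← Real.exp_add]
  apply Real.exp_le_exp.mpr
  have h2 : t ^ 2 / 4 ≤ Real.cosh t := by
    have h3 := Real.quadratic_le_exp_of_nonneg (abs_nonneg t)
    rw [← Real.cosh_abs, Real.cosh_eq]
    have h4 := Real.exp_pos (-|t|)
    have h5 := abs_nonneg t
    rw [sq_abs] at h3
    linarith
  have h3 : z * (t ^ 2 / 4) ≤ z * Real.cosh t := mul_le_mul_of_nonneg_left h2 hz.le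
  have h4 : 0 ≤ (z / 8) * (t + 4 * a / z) ^ 2 := by positivity
  have h5 : (z / 8) * (t + 4 * a / z) ^ 2 = (z / 8) * t ^ 2 + a * t + 2 * a ^ 2 / z := by
    field_simp
    ring
  linarith

lemma besselK_pos (a : ℝ) {z : ℝ} (hz : 0 < z) : 0 < besselK a z := by
  refine mul_pos (by norm_num) ?_
  exact integral_exp_pos (integrable_besselK a hz)

lemma measurable_besselK (a : ℝ) : Measurable (besselK a) := by
  refine Measurable.const_mul ?_ _
  refine StronglyMeasurable.measurable ?_
  refine StronglyMeasurable.integral_prod_right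
    (f := fun (z : ℝ) (t : ℝ) => Real.exp (-z * Real.cosh t - a * t)) ?_
  apply Continuous.stronglyMeasurable
  unfold Function.uncurry
  fun_prop

lemma matern_nonneg (a : ℝ) {z : ℝ} (hz : 0 ≤ z) : 0 ≤ matern a z :=
  mul_nonneg (besselK_nonneg a z) (Real.rpow_nonneg hz _)

lemma matern_pos (a : ℝ) {z : ℝ} (hz : 0 < z) : 0 < matern a z :=
  mul_pos (besselK_pos a hz) (Real.rpow_pos_of_pos hz _)

lemma measurable_matern (a : ℝ) : Measurable (matern a) :=
  (measurable_besselK a).mul (measurable_id.pow_const a)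

/-! ### The Fourier transform on `L²(ℝⁿ)` -/

open Classical in
/-- The `L²` Fourier transform with the normalization `f̂(ξ) = ∫ e^{-iξ·x} f(x) dx`, extended to
`L²` by Plancherel. Mathlib's transform `𝓕` on `L²` uses `e^{-2πi ξ·x}`, hence the dilation. -/
def l2Fourier {n : ℕ} (f : E n → ℂ) : E n → ℂ :=
  if hf : MemLp f 2 (volume : Measure (E n)) then
    fun ξ => (𝓕 (hf.toLp f) : Lp ℂ 2 (volume : Measure (E n))) ((2 * Real.pi)⁻¹ • ξ)
  else 0

lemma quasi_dilation (n : ℕ) :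
    Measure.QuasiMeasurePreserving (fun ξ : E n => (2 * Real.pi)⁻¹ • ξ) volume volume :=
  Measure.quasiMeasurePreserving_smul volume (by positivity)

lemma l2Fourier_of {n : ℕ} {f : E n → ℂ} (hf : MemLp f 2 (volume : Measure (E n))) :
    l2Fourier f =
      fun ξ => (𝓕 (hf.toLp f) : Lp ℂ 2 (volume : Measure (E n))) ((2 * Real.pi)⁻¹ • ξ) := by
  rw [l2Fourier, dif_pos hf]

lemma aestronglyMeasurable_l2Fourier {n : ℕ} (f : E n → ℂ) :
    AEStronglyMeasurable (l2Fourier f) (volume : Measure (E n)) := by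
  by_cases hf : MemLp f 2 (volume : Measure (E n))
  · rw [l2Fourier_of hf]
    exact (Lp.aestronglyMeasurable _).comp_quasiMeasurePreserving (quasi_dilation n)
  · rw [l2Fourier, dif_neg hf]
    exact aestronglyMeasurable_zero

lemma l2Fourier_add {n : ℕ} {f g : E n → ℂ} (hf : MemLp f 2 (volume : Measure (E n)))
    (hg : MemLp g 2 (volume : Measure (E n))) :
    l2Fourier (f + g) =ᵐ[volume] l2Fourier f + l2Fourier g := by
  rw [l2Fourier_of hf, l2Fourier_of hg, l2Fourier_of (hf.add hg), MemLp.toLp_add,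
    FourierAdd.fourier_add]
  exact (quasi_dilation n).ae_eq_comp (Lp.coeFn_add (𝓕 (hf.toLp f)) (𝓕 (hg.toLp g)))

lemma l2Fourier_smul {n : ℕ} (c : ℂ) {f : E n → ℂ} (hf : MemLp f 2 (volume : Measure (E n))) :
    l2Fourier (c • f) =ᵐ[volume] c • l2Fourier f := by
  rw [l2Fourier_of hf, l2Fourier_of (hf.const_smul c), MemLp.toLp_const_smul,
    FourierSMul.fourier_smul]
  exact (quasi_dilation n).ae_eq_comp (Lp.coeFn_smul c (𝓕 (hf.toLp f)))

lemma ae_eq_zero_of_l2Fourier {n : ℕ} {f : E n → ℂ} (hf : MemLp f 2 (volume : Measure (E n)))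
    (h : l2Fourier f =ᵐ[volume] 0) : f =ᵐ[volume] 0 := by
  have hpi : (2 * Real.pi : ℝ) ≠ 0 := by positivity
  rw [l2Fourier_of hf] at h
  have h1 := (Measure.quasiMeasurePreserving_smul (volume : Measure (E n)) hpi).ae_eq_comp h
  have h2 : (𝓕 (hf.toLp f) : Lp ℂ 2 (volume : Measure (E n))) = 0 := by
    apply Lp.ext
    refine Filter.EventuallyEq.trans ?_ (Lp.coeFn_zero ℂ 2 volume).symm
    filter_upwards [h1] with x hx
    simp only [Function.comp, smul_smul, inv_mul_cancel₀ hpi, one_smul] at hx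
    simpa using hx
  have h3 : hf.toLp f = 0 := by
    rw [← norm_eq_zero, ← Lp.norm_fourier_eq, h2, norm_zero]
  refine (MemLp.coeFn_toLp hf).symm.trans ?_
  rw [h3]
  exact Lp.coeFn_zero ℂ 2 volume

/-! ### The space `𝒦_a(ℝⁿ)` -/

/-- `𝒦_a(ℝⁿ)`: the continuous square-integrable `f : ℝⁿ → ℂ` such that
`∫ |f̂(ξ)|² / (K_a(|ξ|) |ξ|^a) dξ < ∞`. -/
def kSpace (n : ℕ) (a : ℝ) : Submodule ℂ (E n → ℂ) where
  carrier := {f | Continuous f ∧ MemLp f 2 (volume : Measure (E n)) ∧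
    Integrable (fun ξ : E n => ‖l2Fourier f ξ‖ ^ 2 / (besselK a ‖ξ‖ * ‖ξ‖ ^ a))}
  zero_mem' := by
    refine ⟨continuous_zero, MemLp.zero, ?_⟩
    have h := l2Fourier_smul (0 : ℂ) (MemLp.zero : MemLp (0 : E n → ℂ) 2 volume)
    simp only [zero_smul] at h
    refine (integrable_zero (E n) ℝ volume).congr ?_
    filter_upwards [h] with ξ hξ
    simp [hξ]
  add_mem' := by
    rintro f g ⟨hfc, hf, hfi⟩ ⟨hgc, hg, hgi⟩
    refine ⟨hfc.add hgc, hf.add hg, ?_⟩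
    refine ((hfi.const_mul 2).add (hgi.const_mul 2)).mono' ?_ ?_
    · refine AEStronglyMeasurable.div₀ ((aestronglyMeasurable_l2Fourier _).norm.pow 2) ?_
      exact ((measurable_matern a).comp measurable_norm).aestronglyMeasurable
    · filter_upwards [l2Fourier_add hf hg] with ξ hξ
      have hw : 0 ≤ besselK a ‖ξ‖ * ‖ξ‖ ^ a := matern_nonneg a (norm_nonneg ξ)
      rw [Real.norm_of_nonneg (div_nonneg (sq_nonneg _) hw), hξ]
      simp only [Pi.add_apply]
      rw [← mul_div_assoc, ← mul_div_assoc, ← add_div]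
      refine div_le_div_of_nonneg_right ?_ hw
      have h1 := norm_add_le (l2Fourier f ξ) (l2Fourier g ξ)
      have h2 : ‖l2Fourier f ξ + l2Fourier g ξ‖ ^ 2 ≤ (‖l2Fourier f ξ‖ + ‖l2Fourier g ξ‖) ^ 2 :=
        pow_le_pow_left₀ (norm_nonneg _) h1 2
      nlinarith [sq_nonneg (‖l2Fourier f ξ‖ - ‖l2Fourier g ξ‖)]
  smul_mem' := by
    rintro c f ⟨hfc, hf, hfi⟩
    refine ⟨hfc.const_smul c, hf.const_smul c, ?_⟩
    refine (hfi.const_mul (‖c‖ ^ 2)).congr ?_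
    filter_upwards [l2Fourier_smul c hf] with ξ hξ
    rw [hξ]
    simp only [Pi.smul_apply, norm_smul, mul_pow, mul_div_assoc]

/-- The integrand of the inner product of `f` and `g`. -/
def innerIntegrand (n : ℕ) (b : ℝ) (f g : E n → ℂ) (ξ : E n) : ℂ :=
  l2Fourier f ξ * conj (l2Fourier g ξ) / (besselPotential n b ‖ξ‖ : ℂ)

/-- The inner product `(2π)^{-2n} ∫ f̂(ξ) conj(ĝ(ξ)) / G_b(ξ) dξ`. -/
def innerForm (n : ℕ) (b : ℝ) (f g : E n → ℂ) : ℂ :=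
  ((((2 * Real.pi) ^ (2 * n))⁻¹ : ℝ) : ℂ) * ∫ ξ : E n, innerIntegrand n b f g ξ

lemma besselPotential_const_pos (n : ℕ) {b : ℝ} (hb : 0 < b) :
    0 < 1 / ((2 : ℝ) ^ (b - 1 + (n : ℝ) / 2) * Real.pi ^ ((n : ℝ) / 2) * Real.Gamma b) := by
  have h1 := Real.Gamma_pos_of_pos hb
  have h2 := Real.pi_pos
  positivity

lemma besselPotential_pos (n : ℕ) {b z : ℝ} (hb : 0 < b) (hz : 0 < z) :
    0 < besselPotential n b z :=
  mul_pos (besselPotential_const_pos n hb) (matern_pos _ hz)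

lemma measurable_besselPotential (n : ℕ) (b : ℝ) : Measurable (besselPotential n b) :=
  (measurable_matern (b - (n : ℝ) / 2)).const_mul _

lemma pos_of_half_lt {n : ℕ} {b : ℝ} (hb : (n : ℝ) / 2 < b) : 0 < b :=
  lt_of_le_of_lt (by positivity) hb

lemma integrable_weight {n : ℕ} {b : ℝ} {f : E n → ℂ}
    (hf : f ∈ kSpace n (b - (n : ℝ) / 2)) :
    Integrable (fun ξ : E n => ‖l2Fourier f ξ‖ ^ 2 / besselPotential n b ‖ξ‖) := by
  refine (hf.2.2.const_mul
    (1 / ((2 : ℝ) ^ (b - 1 + (n : ℝ) / 2) * Real.pi ^ ((n : ℝ) / 2) * Real.Gamma b))⁻¹).congr ?_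
  refine Filter.Eventually.of_forall fun ξ => ?_
  simp only [besselPotential]
  generalize (1 / ((2 : ℝ) ^ (b - 1 + (n : ℝ) / 2) * Real.pi ^ ((n : ℝ) / 2) * Real.Gamma b)) = c
  simp only [div_eq_mul_inv, mul_inv]
  ring

lemma integrable_innerIntegrand {n : ℕ} {b : ℝ} (hb : 0 < b) {f g : E n → ℂ}
    (hf : f ∈ kSpace n (b - (n : ℝ) / 2)) (hg : g ∈ kSpace n (b - (n : ℝ) / 2)) :
    Integrable (innerIntegrand n b f g) := by
  refine ((integrable_weight hf).add (integrable_weight hg)).mono' ?_ ?_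
  · refine AEStronglyMeasurable.div₀ ((aestronglyMeasurable_l2Fourier f).mul
      (Complex.continuous_conj.comp_aestronglyMeasurable (aestronglyMeasurable_l2Fourier g))) ?_
    exact (Complex.measurable_ofReal.comp
      ((measurable_besselPotential n b).comp measurable_norm)).aestronglyMeasurable
  · refine Filter.Eventually.of_forall fun ξ => ?_
    have hw : 0 ≤ besselPotential n b ‖ξ‖ :=
      mul_nonneg (besselPotential_const_pos n hb).le (matern_nonneg _ (norm_nonneg ξ))
    simp only [innerIntegrand, Pi.add_apply]
    rw [norm_div, norm_mul, RCLike.norm_conj, Complex.norm_real, Real.norm_of_nonneg hw,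
      ← add_div]
    refine div_le_div_of_nonneg_right ?_ hw
    nlinarith [sq_nonneg (‖l2Fourier f ξ‖ - ‖l2Fourier g ξ‖),
      sq_nonneg (‖l2Fourier f ξ‖), sq_nonneg (‖l2Fourier g ξ‖)]

lemma innerForm_self (n : ℕ) (b : ℝ) (f : E n → ℂ) :
    innerForm n b f f = (((((2 * Real.pi) ^ (2 * n))⁻¹ *
      ∫ ξ : E n, ‖l2Fourier f ξ‖ ^ 2 / besselPotential n b ‖ξ‖ : ℝ)) : ℂ) := by
  rw [innerForm, Complex.ofReal_mul, ← integral_complex_ofReal]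
  congr 2
  funext ξ
  rw [innerIntegrand, Complex.mul_conj']
  push_cast
  rfl

lemma eq_zero_of_innerForm {n : ℕ} {b : ℝ} (hn : 0 < n) (hb : 0 < b) {f : E n → ℂ}
    (hf : f ∈ kSpace n (b - (n : ℝ) / 2)) (h : innerForm n b f f = 0) : f = 0 := by
  rw [innerForm_self] at h
  have h1 := Complex.ofReal_eq_zero.mp h
  have hc : ((2 * Real.pi) ^ (2 * n))⁻¹ ≠ (0 : ℝ) := by positivity
  have h2 := (mul_eq_zero.mp h1).resolve_left hc
  have h0 : 0 ≤ fun ξ : E n => ‖l2Fourier f ξ‖ ^ 2 / besselPotential n b ‖ξ‖ := fun ξ =>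
    div_nonneg (sq_nonneg _)
      (mul_nonneg (besselPotential_const_pos n hb).le (matern_nonneg _ (norm_nonneg ξ)))
  rw [integral_eq_zero_iff_of_nonneg h0 (integrable_weight hf)] at h2
  have : Nonempty (Fin n) := ⟨⟨0, hn⟩⟩
  have h3 : l2Fourier f =ᵐ[volume] 0 := by
    filter_upwards [h2, Measure.ae_ne volume (0 : E n)] with ξ hξ hne
    have hpos := besselPotential_pos n hb (norm_pos_iff.mpr hne)
    simpa [hpos.ne'] using hξ
  exact (Continuous.ae_eq_iff_eq volume hf.1 continuous_zero).mp
    (ae_eq_zero_of_l2Fourier hf.2.1 h3)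

/-- The vector space `𝒦_{b-n/2}(ℝⁿ)`, `b > n/2`, on which the inner product is put below. (A new
name for the type, so that it does not inherit the topology of pointwise convergence.) -/
def KHilbert (n : ℕ) (b : ℝ) (_hn : 0 < n) (_hb : (n : ℝ) / 2 < b) : Type :=
  ↥(kSpace n (b - (n : ℝ) / 2))

namespace KHilbert

variable {n : ℕ} {b : ℝ} {hn : 0 < n} {hb : (n : ℝ) / 2 < b}

instance instAddCommGroup : AddCommGroup (KHilbert n b hn hb) :=
  inferInstanceAs (AddCommGroup ↥(kSpace n (b - (n : ℝ) / 2)))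

instance instModule : Module ℂ (KHilbert n b hn hb) :=
  inferInstanceAs (Module ℂ ↥(kSpace n (b - (n : ℝ) / 2)))

/-- The function `ℝⁿ → ℂ` that an element of the space is. -/
def toFun : KHilbert n b hn hb →ₗ[ℂ] (E n → ℂ) := (kSpace n (b - (n : ℝ) / 2)).subtype

lemma toFun_mem (f : KHilbert n b hn hb) : toFun f ∈ kSpace n (b - (n : ℝ) / 2) := f.2

lemma toFun_injective : Function.Injective (toFun : KHilbert n b hn hb → E n → ℂ) :=
  Subtype.val_injective

lemma range_toFun :
    Set.range (toFun : KHilbert n b hn hb → E n → ℂ) = kSpace n (b - (n : ℝ) / 2) :=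
  Subtype.range_val

/-- The inner product. Mathlib's inner product is linear in the second variable, so
`⟪g, f⟫ = (2π)^{-2n} ∫ f̂ conj(ĝ) / G_b`. -/
@[reducible]
def innerCore : InnerProductSpace.Core ℂ (KHilbert n b hn hb) where
  inner g f := innerForm n b (toFun f) (toFun g)
  conj_inner_symm f g := by
    simp only [innerForm, map_mul, Complex.conj_ofReal, ← integral_conj]
    congr 2
    funext ξ
    simp only [innerIntegrand, map_div₀, map_mul, Complex.conj_conj, Complex.conj_ofReal]
    rw [mul_comm]
  re_inner_nonneg f := by
    rw [innerForm_self]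
    simp only [RCLike.re_to_complex, Complex.ofReal_re]
    refine mul_nonneg (by positivity) (integral_nonneg fun ξ => div_nonneg (sq_nonneg _) ?_)
    exact mul_nonneg (besselPotential_const_pos n (pos_of_half_lt hb)).le
      (matern_nonneg _ (norm_nonneg ξ))
  add_left f g h := by
    have hb' := pos_of_half_lt hb
    simp only [innerForm]
    rw [← mul_add, ← integral_add (integrable_innerIntegrand hb' (toFun_mem h) (toFun_mem f))
      (integrable_innerIntegrand hb' (toFun_mem h) (toFun_mem g))]
    congr 1
    refine integral_congr_ae ?_
    rw [map_add]
    filter_upwards [l2Fourier_add (toFun_mem f).2.1 (toFun_mem g).2.1] with ξ hξ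
    simp only [innerIntegrand, hξ, Pi.add_apply, map_add]
    ring
  smul_left f g c := by
    simp only [innerForm]
    rw [mul_left_comm]
    congr 1
    refine Eq.trans ?_ (integral_const_mul (μ := (volume : Measure (E n))) (conj c)
      (innerIntegrand n b (toFun g) (toFun f)))
    refine integral_congr_ae ?_
    rw [map_smul]
    filter_upwards [l2Fourier_smul c (toFun_mem f).2.1] with ξ hξ
    simp only [innerIntegrand, hξ, Pi.smul_apply, smul_eq_mul, map_mul]
    ring
  definite f hf := toFun_injective (by
    rw [map_zero]
    exact eq_zero_of_innerForm hn (pos_of_half_lt hb) (toFun_mem f) hf)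

instance instNormedAddCommGroup : NormedAddCommGroup (KHilbert n b hn hb) :=
  innerCore.toNormedAddCommGroup

instance instInnerProductSpace : InnerProductSpace ℂ (KHilbert n b hn hb) :=
  InnerProductSpace.ofCore innerCore.toCore

lemma inner_eq (f g : KHilbert n b hn hb) :
    ⟪g, f⟫_ℂ = innerForm n b (toFun f) (toFun g) := rfl

end KHilbert

/-! ### Reproducing kernels, Riesz sequences, separation -/

/-- `k` is the reproducing kernel of the reproducing kernel Hilbert space `H` of complex-valued
functions on `X`: the function `x ↦ k x y` belongs to `H` and represents evaluation at `y`. -/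
def HasReproducingKernel {X : Type*} (H : Type*) [NormedAddCommGroup H] [InnerProductSpace ℂ H]
    [CompleteSpace H] [RKHS ℂ H X ℂ] (k : X → X → ℂ) : Prop :=
  ∀ x y : X, RKHS.kernel H x y 1 = k x y

/-- A sequence `(f_j)` in a Hilbert space `H` is a Riesz sequence if its moment space
`{((f, f_j)_H)_j : f ∈ H}` is equal to `ℓ²(ℕ)`. -/
def IsRieszSequence {H : Type*} [NormedAddCommGroup H] [InnerProductSpace ℂ H]
    (f : ℕ → H) : Prop :=
  Set.range (fun (h : H) (j : ℕ) => ⟪f j, h⟫_ℂ) = {m : ℕ → ℂ | Memℓp m 2}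

/-- The separation `δ(X) = inf_{j ≠ k} |x_j - x_k|`. -/
def separation {n : ℕ} (x : ℕ → E n) : ℝ :=
  ⨅ p : {p : ℕ × ℕ // p.1 ≠ p.2}, ‖x p.1.1 - x p.1.2‖

end

end Multiquadric

open Multiquadric

/-! Everything rests on the Gamma integral `Γ(β)(1+r²)^{-β} = ∫₀^∞ u^{β-1} e^{-u} e^{-ur²} du`,
which exhibits the inverse multiquadric as a positive mixture of Gaussians.

For (i), transforming the mixture under the integral gives a Schläfli integral, so away from the
origin the Fourier transform of `φ_β` is the positive function `p = (2π)^n G_β`, in the variable `ξ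
= 2πw` (`fourier_invMultiquadric`). It is integrable and bounded. Hence `f ↦ f̂/√p` is an isometry
of the space onto `L²`: given `h ∈ L²`, the function `h√p` lies in `L¹ ∩ L²`, so its inverse
transform is continuous and square integrable (`toL2_surjective`). This gives completeness. In the
inner product with `φ_β(· - y)` the weight `1/p` cancels, and Fourier inversion leaves `f(y)`
(`inner_translate`). Uniqueness holds because a kernel determines the inner products of its
sections, whose span is dense.

For (ii), the Gram matrix has entries `(1+|x_j-x_k|²)^{-β}`. Schur's test bounds it above, since the
row sums of a separated set are dominated by `∫ (1+|y|²)^{-β} dy`. For the lower bound, every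
Gaussian in the mixture is positive semidefinite, and those with `u ≥ T` have off-diagonal row sums
at most `1/2`, so they alone contribute a positive multiple of the identity
(`exists_le_sum_sum_one_add_sq_rpow`). Two-sided Gram bounds give a Riesz sequence by Hahn–Banach
and the Riesz representation theorem. -/

namespace Multiquadric

/-! ### The `L²` Fourier transform on `L¹ ∩ L²` -/

section Plancherel

open SchwartzMap

variable {V : Type*} [NormedAddCommGroup V] [InnerProductSpace ℝ V] [FiniteDimensional ℝ V]
  [MeasurableSpace V] [BorelSpace V]

lemma continuous_fourier {f : V → ℂ} (hf : Integrable f) : Continuous (𝓕 f) :=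
  VectorFourier.fourierIntegral_continuous Real.continuous_fourierChar
    (L := innerₗ V) continuous_inner hf

lemma continuous_fourierInv {f : V → ℂ} (hf : Integrable f) : Continuous (𝓕⁻ f) := by
  have h : 𝓕⁻ f = fun x => 𝓕 f (-x) := funext fun x => Real.fourierInv_eq_fourier_neg f x
  rw [h]
  exact (continuous_fourier hf).comp continuous_neg

lemma integral_fourier_smul_eq_of_integrable {f g : V → ℂ} (hf : Integrable f)
    (hg : Integrable g) : ∫ ξ, 𝓕 f ξ • g ξ = ∫ x, f x • 𝓕 g x := by
  simpa using! VectorFourier.integral_fourierIntegral_smul_eq_flip (L := innerₗ V)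
    Real.continuous_fourierChar continuous_inner hf hg

/-- The `L²` Fourier transform of a function in `L¹ ∩ L²` is given by the Fourier integral. -/
lemma fourier_toLp_ae_eq {f : V → ℂ} (h1 : Integrable f) (h2 : MemLp f 2) :
    (𝓕 (h2.toLp f) : Lp ℂ 2 (volume : Measure V)) =ᵐ[volume] 𝓕 f := by
  -- Both sides are tested against smooth compactly supported functions. These are Schwartz, so the
  -- distributional definition moves the `L²` transform onto the test function, and Fubini moves it
  -- back as a Fourier integral.
  refine ae_eq_of_integral_contDiff_smul_eq
    ((Lp.memLp _).locallyIntegrable (by norm_num))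
    (continuous_fourier h1).locallyIntegrable fun g hg hgs => ?_
  have hc : HasCompactSupport fun x => (g x : ℂ) := hgs.comp_left Complex.ofReal_zero
  have hd : ContDiff ℝ (⊤ : ℕ∞) fun x => (g x : ℂ) := Complex.ofRealCLM.contDiff.comp hg
  set G : 𝓢(V, ℂ) := hc.toSchwartzMap hd with hG
  have e1 : ∀ x, G x = (g x : ℂ) := fun x => rfl
  have h := DFunLike.congr_fun (Lp.fourier_toTemperedDistribution_eq (h2.toLp f)) G
  rw [TemperedDistribution.fourier_apply, Lp.toTemperedDistribution_apply,
    Lp.toTemperedDistribution_apply] at h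
  have h3 : ∫ x, (𝓕 G : 𝓢(V, ℂ)) x • (h2.toLp f) x = ∫ x, G x • 𝓕 f x := by
    rw [← integral_fourier_smul_eq_of_integrable G.integrable h1]
    refine integral_congr_ae ?_
    filter_upwards [h2.coeFn_toLp] with x hx
    rw [hx]
    rfl
  rw [h3] at h
  simp only [e1, smul_eq_mul] at h
  simp only [Complex.real_smul]
  exact h.symm

/-- The `L²` inverse Fourier transform of a function in `L¹ ∩ L²` is given by the inverse Fourier
integral. -/
lemma fourierInv_toLp_ae_eq {f : V → ℂ} (h1 : Integrable f) (h2 : MemLp f 2) :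
    (𝓕⁻ (h2.toLp f) : Lp ℂ 2 (volume : Measure V)) =ᵐ[volume] 𝓕⁻ f := by
  refine ae_eq_of_integral_contDiff_smul_eq
    ((Lp.memLp _).locallyIntegrable (by norm_num))
    (continuous_fourierInv h1).locallyIntegrable fun g hg hgs => ?_
  have hc : HasCompactSupport fun x => (g x : ℂ) := hgs.comp_left Complex.ofReal_zero
  have hd : ContDiff ℝ (⊤ : ℕ∞) fun x => (g x : ℂ) := Complex.ofRealCLM.contDiff.comp hg
  set G : 𝓢(V, ℂ) := hc.toSchwartzMap hd with hG
  have e1 : ∀ x, G x = (g x : ℂ) := fun x => rfl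
  have h := DFunLike.congr_fun (Lp.fourierInv_toTemperedDistribution_eq (h2.toLp f)) G
  rw [TemperedDistribution.fourierInv_apply, Lp.toTemperedDistribution_apply,
    Lp.toTemperedDistribution_apply] at h
  have h3 : ∫ x, (𝓕⁻ G : 𝓢(V, ℂ)) x • (h2.toLp f) x = ∫ x, G x • 𝓕⁻ f x := by
    -- Reflecting the variable replaces `𝓕⁻` by `𝓕`, to which the Fubini identity applies.
    have h4 : ∫ x, G x • 𝓕⁻ f x = ∫ x, G (-x) • 𝓕 f x := by
      rw [← integral_neg_eq_self]
      simp only [Real.fourierInv_eq_fourier_neg, neg_neg]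
    rw [h4, ← integral_fourier_smul_eq_of_integrable (G.integrable.comp_neg) h1]
    refine integral_congr_ae ?_
    filter_upwards [h2.coeFn_toLp] with x hx
    rw [hx]
    congr 1
    rw [SchwartzMap.fourierInv_coe, Real.fourierInv_eq_fourier_comp_neg]
  rw [h3] at h
  simp only [e1, smul_eq_mul] at h
  simp only [Complex.real_smul]
  exact h.symm

end Plancherel

/-! ### Uniqueness of the Hilbert space with a given kernel -/

section Uniqueness

variable {X : Type*}

lemma kerFun_smul_one {H : Type*} [NormedAddCommGroup H] [InnerProductSpace ℂ H]
    [CompleteSpace H] [RKHS ℂ H X ℂ] (y : X) (c : ℂ) :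
    RKHS.kerFun H y c = c • RKHS.kerFun H y 1 := by
  rw [← map_smul, smul_eq_mul, mul_one]

lemma denseRange_linearCombination_kerFun (H : Type*) [NormedAddCommGroup H]
    [InnerProductSpace ℂ H] [CompleteSpace H] [RKHS ℂ H X ℂ] :
    DenseRange (Finsupp.linearCombination ℂ fun y : X => RKHS.kerFun H y (1 : ℂ)) := by
  have h := RKHS.kerFun_dense (𝕜 := ℂ) (X := X) (V := ℂ) H
  rw [← Submodule.dense_iff_topologicalClosure_eq_top] at h
  refine h.mono ?_
  have h2 : Submodule.span ℂ {x : H | ∃ (y : X) (v : ℂ), RKHS.kerFun H y v = x} ≤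
      LinearMap.range (Finsupp.linearCombination ℂ fun y : X => RKHS.kerFun H y (1 : ℂ)) := by
    rw [Submodule.span_le]
    rintro _ ⟨y, v, rfl⟩
    exact ⟨Finsupp.single y v, by
      rw [Finsupp.linearCombination_single, kerFun_smul_one y v]⟩
  exact h2

/-- The right-hand side involves only `k`, so finite combinations of kernel sections have the same
Gram form in every space with this kernel. -/
lemma inner_linearCombination_kerFun (H : Type*) [NormedAddCommGroup H]
    [InnerProductSpace ℂ H] [CompleteSpace H] [RKHS ℂ H X ℂ] {k : X → X → ℂ}
    (hk : HasReproducingKernel H k) (c d : X →₀ ℂ) :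
    ⟪Finsupp.linearCombination ℂ (fun y : X => RKHS.kerFun H y (1 : ℂ)) c,
      Finsupp.linearCombination ℂ (fun y : X => RKHS.kerFun H y (1 : ℂ)) d⟫_ℂ =
      c.sum fun x a => conj a * d.sum fun y b => b * k x y := by
  rw [Finsupp.linearCombination_apply, Finsupp.sum_inner]
  refine Finsupp.sum_congr fun x _ => ?_
  rw [Finsupp.linearCombination_apply, Finsupp.inner_sum, Finsupp.mul_sum]
  refine Finsupp.sum_congr fun y _ => ?_
  rw [inner_smul_left, inner_smul_right, RKHS.kerFun_inner, RKHS.kerFun_apply, hk]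
  simp

/-- Two Hilbert spaces of functions with the same reproducing kernel coincide. -/
lemma exists_linearIsometryEquiv_of_kernel_eq {H K : Type*} [NormedAddCommGroup H]
    [InnerProductSpace ℂ H] [CompleteSpace H] [RKHS ℂ H X ℂ] [NormedAddCommGroup K]
    [InnerProductSpace ℂ K] [CompleteSpace K] [RKHS ℂ K X ℂ] {k : X → X → ℂ}
    (hH : HasReproducingKernel H k) (hK : HasReproducingKernel K k) :
    ∃ e : H ≃ₗᵢ[ℂ] K, ∀ (h : H) (x : X), e h x = h x := by
  -- Equal norms for equal coefficients let the identity on coefficients extend to an isometry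
  -- between the two completions.
  have hn : ∀ c : X →₀ ℂ,
      ‖Finsupp.linearCombination ℂ (fun y : X => RKHS.kerFun K y (1 : ℂ))
        (LinearEquiv.refl ℂ (X →₀ ℂ) c)‖ =
      ‖Finsupp.linearCombination ℂ (fun y : X => RKHS.kerFun H y (1 : ℂ)) c‖ := fun c => by
    rw [← sq_eq_sq₀ (norm_nonneg _) (norm_nonneg _)]
    have h := (inner_linearCombination_kerFun K hK c c).trans
      (inner_linearCombination_kerFun H hH c c).symm
    rw [inner_self_eq_norm_sq_to_K, inner_self_eq_norm_sq_to_K] at h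
    exact_mod_cast h
  refine ⟨(LinearEquiv.refl ℂ (X →₀ ℂ)).extendOfIsometry _ _
    (denseRange_linearCombination_kerFun H) (denseRange_linearCombination_kerFun K) hn,
    fun h x => ?_⟩
  set e := (LinearEquiv.refl ℂ (X →₀ ℂ)).extendOfIsometry _ _
    (denseRange_linearCombination_kerFun H) (denseRange_linearCombination_kerFun K) hn
  -- Since sections go to sections, point evaluations are preserved.
  have h1 : e (RKHS.kerFun H x 1) = RKHS.kerFun K x 1 := by
    have := LinearEquiv.extendOfIsometry_eq (LinearEquiv.refl ℂ (X →₀ ℂ)) _ _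
      (denseRange_linearCombination_kerFun H) (denseRange_linearCombination_kerFun K) hn
      (Finsupp.single x 1)
    simpa using this
  have h2 : ⟪RKHS.kerFun K x 1, e h⟫_ℂ = ⟪RKHS.kerFun H x 1, h⟫_ℂ := by
    rw [← h1, e.inner_map_map]
  rw [RKHS.kerFun_inner, RKHS.kerFun_inner] at h2
  simpa using h2

end Uniqueness

/-! ### Riesz sequences from Gram bounds -/

section RieszSequence

variable {H : Type*} [NormedAddCommGroup H] [InnerProductSpace ℂ H]

lemma norm_sum_mul_le_sqrt (s : Finset ℕ) (c d : ℕ → ℂ) :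
    ‖∑ j ∈ s, c j * d j‖ ≤ √(∑ j ∈ s, ‖c j‖ ^ 2) * √(∑ j ∈ s, ‖d j‖ ^ 2) := by
  refine (norm_sum_le _ _).trans ?_
  simp only [norm_mul]
  exact Real.sum_mul_le_sqrt_mul_sqrt s _ _

/-- Bessel's inequality by duality: pairing `h` with `v = ∑ ⟪f j, h⟫ f j` gives `S ≤ ‖v‖ ‖h‖`, while
the hypothesis gives `‖v‖² ≤ b S`. -/
lemma summable_inner_of_le {f : ℕ → H} {b : ℝ}
    (hb : ∀ (s : Finset ℕ) (c : ℕ → ℂ),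
      ‖∑ j ∈ s, c j • f j‖ ^ 2 ≤ b * ∑ j ∈ s, ‖c j‖ ^ 2) (h : H) :
    Summable fun j => ‖⟪f j, h⟫_ℂ‖ ^ 2 := by
  refine summable_of_sum_le (c := b * ‖h‖ ^ 2) (fun _ => sq_nonneg _) fun s => ?_
  set S := ∑ j ∈ s, ‖⟪f j, h⟫_ℂ‖ ^ 2 with hS
  set v := ∑ j ∈ s, ⟪f j, h⟫_ℂ • f j with hv
  have h1 : ⟪v, h⟫_ℂ = (S : ℂ) := by
    rw [hv, sum_inner, hS]
    push_cast
    refine Finset.sum_congr rfl fun j _ => ?_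
    rw [inner_smul_left, mul_comm, Complex.mul_conj']
  have h2 : S ≤ ‖v‖ * ‖h‖ := by
    have h3 := norm_inner_le_norm (𝕜 := ℂ) v h
    rw [h1, Complex.norm_real] at h3
    exact (le_abs_self S).trans h3
  have h3 : ‖v‖ ^ 2 ≤ b * S := hb s _
  have h0 : 0 ≤ S := Finset.sum_nonneg fun _ _ => sq_nonneg _
  -- If `S > 0`, one divides by `S`. If `S = 0`, the sign of `b` is needed, and testing the bound on
  -- the single vector `f 0` excludes `b < 0`.
  rcases h0.eq_or_lt with h0 | h0
  · rw [← h0]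
    by_contra! hneg
    have hb' : b < 0 := by
      by_contra! hb'
      exact absurd hneg (not_lt.mpr (by positivity))
    have hh : h ≠ 0 := by
      rintro rfl
      simp at hneg
    have := hb {0} (fun _ => 1)
    simp at this
    nlinarith [sq_nonneg ‖f 0‖]
  · have h4 : S ^ 2 ≤ b * S * ‖h‖ ^ 2 := by
      calc S ^ 2 ≤ (‖v‖ * ‖h‖) ^ 2 := pow_le_pow_left₀ h0.le h2 2
        _ = ‖v‖ ^ 2 * ‖h‖ ^ 2 := by ring
        _ ≤ _ := mul_le_mul_of_nonneg_right h3 (sq_nonneg _)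
    nlinarith

/-- By the lower bound and Cauchy–Schwarz, `f j ↦ conj (m j)` is a well-defined bounded functional
on the span. It extends by Hahn–Banach and is represented by a vector; the conjugate compensates for
the order of the inner product. -/
lemma exists_inner_eq_of_le [CompleteSpace H] {f : ℕ → H} {a : ℝ} (ha : 0 < a)
    (hab : ∀ (s : Finset ℕ) (c : ℕ → ℂ),
      a * ∑ j ∈ s, ‖c j‖ ^ 2 ≤ ‖∑ j ∈ s, c j • f j‖ ^ 2)
    {m : ℕ → ℂ} (hm : Summable fun j => ‖m j‖ ^ 2) : ∃ h : H, ∀ j, ⟪f j, h⟫_ℂ = m j := by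
  set T := Finsupp.linearCombination ℂ f
  set L := Finsupp.linearCombination ℂ fun j => conj (m j)
  have hTL : ∃ C : ℝ, ∀ c : ℕ →₀ ℂ, ‖L c‖ ≤ C * ‖T c‖ := by
    refine ⟨√(∑' j, ‖m j‖ ^ 2) / √a, fun c => ?_⟩
    have h1 : ‖L c‖ ≤ √(∑ j ∈ c.support, ‖c j‖ ^ 2) * √(∑' j, ‖m j‖ ^ 2) := by
      refine (norm_sum_mul_le_sqrt c.support c fun j => conj (m j)).trans ?_
      refine mul_le_mul_of_nonneg_left (Real.sqrt_le_sqrt ?_) (Real.sqrt_nonneg _)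
      simp only [RCLike.norm_conj]
      exact hm.sum_le_tsum _ fun _ _ => sq_nonneg _
    have h2 : √a * √(∑ j ∈ c.support, ‖c j‖ ^ 2) ≤ ‖T c‖ := by
      rw [← Real.sqrt_mul ha.le]
      exact Real.sqrt_le_iff.mpr ⟨norm_nonneg _, hab c.support c⟩
    have h3 : 0 < √a := Real.sqrt_pos.mpr ha
    rw [div_mul_eq_mul_div, le_div_iff₀ h3]
    calc ‖L c‖ * √a ≤ √(∑ j ∈ c.support, ‖c j‖ ^ 2) * √(∑' j, ‖m j‖ ^ 2) * √a :=
          mul_le_mul_of_nonneg_right h1 h3.le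
      _ = √(∑' j, ‖m j‖ ^ 2) * (√a * √(∑ j ∈ c.support, ‖c j‖ ^ 2)) := by ring
      _ ≤ _ := mul_le_mul_of_nonneg_left h2 (Real.sqrt_nonneg _)
  obtain ⟨g, hg, -⟩ := exists_extension_norm_eq (LinearMap.range T) (L.compLeftInverse T)
  refine ⟨(InnerProductSpace.toDual ℂ H).symm g, fun j => ?_⟩
  have hj : T (Finsupp.single j 1) = f j := by simp [T]
  have h1 := hg ⟨f j, ⟨Finsupp.single j 1, hj⟩⟩
  rw [LinearMap.compLeftInverse_apply_of_bdd L T hTL _ _ hj] at h1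
  have h2 : ⟪(InnerProductSpace.toDual ℂ H).symm g, f j⟫_ℂ = conj (m j) := by
    rw [InnerProductSpace.toDual_symm_apply]
    simpa [L] using h1
  rw [← inner_conj_symm, h2, Complex.conj_conj]

lemma memlp_two_iff_summable {m : ℕ → ℂ} : Memℓp m 2 ↔ Summable fun j => ‖m j‖ ^ 2 := by
  rw [memℓp_gen_iff (by norm_num)]
  simp

/-- A sequence whose Gram operator is bounded above and below on finitely supported sequences is a
Riesz sequence. -/
lemma isRieszSequence_of_le_of_le [CompleteSpace H] {f : ℕ → H} {a b : ℝ} (ha : 0 < a)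
    (hl : ∀ (s : Finset ℕ) (c : ℕ → ℂ),
      a * ∑ j ∈ s, ‖c j‖ ^ 2 ≤ ‖∑ j ∈ s, c j • f j‖ ^ 2)
    (hu : ∀ (s : Finset ℕ) (c : ℕ → ℂ),
      ‖∑ j ∈ s, c j • f j‖ ^ 2 ≤ b * ∑ j ∈ s, ‖c j‖ ^ 2) : IsRieszSequence f := by
  refine Set.eq_of_subset_of_subset ?_ fun m hm => ?_
  · rintro _ ⟨h, rfl⟩
    exact memlp_two_iff_summable.mpr (summable_inner_of_le hu h)
  · obtain ⟨h, hh⟩ := exists_inner_eq_of_le ha hl (memlp_two_iff_summable.mp hm)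
    exact ⟨h, funext hh⟩

end RieszSequence

/-! ### Row sums over separated sets and Schur's test -/

section GramMatrix

lemma separation_le {n : ℕ} (x : ℕ → E n) {j k : ℕ} (h : j ≠ k) :
    separation x ≤ ‖x j - x k‖ :=
  ciInf_le (f := fun p : {p : ℕ × ℕ // p.1 ≠ p.2} => ‖x p.1.1 - x p.1.2‖)
    ⟨0, by rintro _ ⟨p, rfl⟩; exact norm_nonneg _⟩ ⟨(j, k), h⟩

lemma integrable_one_add_sq_rpow {n : ℕ} {b : ℝ} (hb : (n : ℝ) / 2 < b) :
    Integrable fun y : E n => (1 + ‖y‖ ^ 2) ^ (-b) := by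
  have h := integrable_rpow_neg_one_add_norm_sq (μ := (volume : Measure (E n))) (r := 2 * b)
    (by rw [finrank_euclideanSpace_fin]; linarith)
  convert! h using 3
  ring

/-- A Harnack-type comparison, used to replace point values by averages over balls. It follows from
`1+‖y‖² ≤ (2+2ρ²)(1+‖z‖²)`. -/
lemma one_add_sq_rpow_le {n : ℕ} {b ρ : ℝ} (hb : 0 < b) {y z : E n} (h : y ∈ Metric.ball z ρ) :
    (1 + ‖z‖ ^ 2) ^ (-b) ≤ (2 + 2 * ρ ^ 2) ^ b * (1 + ‖y‖ ^ 2) ^ (-b) := by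
  have h1 : ‖y‖ ≤ ‖z‖ + ρ := by
    have h2 := norm_le_norm_add_norm_sub' y z
    rw [← dist_eq_norm] at h2
    linarith [Metric.mem_ball.mp h]
  have h3 : 1 + ‖y‖ ^ 2 ≤ (2 + 2 * ρ ^ 2) * (1 + ‖z‖ ^ 2) := by
    have h4 := pow_le_pow_left₀ (norm_nonneg y) h1 2
    nlinarith [sq_nonneg (‖z‖ - ρ), mul_nonneg (sq_nonneg ρ) (sq_nonneg ‖z‖), sq_nonneg ‖z‖]
  have h5 : (2 + 2 * ρ ^ 2) ^ b * (1 + ‖y‖ ^ 2) ^ (-b) =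
      ((1 + ‖y‖ ^ 2) / (2 + 2 * ρ ^ 2)) ^ (-b) := by
    rw [Real.div_rpow (by positivity) (by positivity), Real.rpow_neg (x := 2 + 2 * ρ ^ 2)
      (by positivity), div_inv_eq_mul, mul_comm]
  rw [h5]
  refine Real.rpow_le_rpow_of_nonpos (by positivity) ?_ (by linarith)
  rw [div_le_iff₀ (by positivity)]
  linarith

/-- The sums of the values of an inverse multiquadric over the differences of a separated sequence
are bounded. -/
lemma exists_sum_one_add_sq_rpow_le {n : ℕ} {b : ℝ} (hb : (n : ℝ) / 2 < b) {x : ℕ → E n}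
    (hx : 0 < separation x) :
    ∃ S : ℝ, ∀ (s : Finset ℕ) (j : ℕ), ∑ k ∈ s, (1 + ‖x j - x k‖ ^ 2) ^ (-b) ≤ S := by
  have hb0 := pos_of_half_lt hb
  set ρ := separation x / 2 with hρ
  have hρ0 : 0 < ρ := by positivity
  set C : ℝ := (2 + 2 * ρ ^ 2) ^ b with hC
  have hC0 : 0 < C := by positivity
  set v : ℝ := (volume : Measure (E n)).real (Metric.ball 0 ρ) with hv
  have hv0 : 0 < v := ENNReal.toReal_pos (Metric.measure_ball_pos volume 0 hρ0).ne' measure_ball_lt_top.ne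
  have hint := integrable_one_add_sq_rpow hb
  refine ⟨C * (∫ y : E n, (1 + ‖y‖ ^ 2) ^ (-b)) / v, fun s j => ?_⟩
  rw [le_div_iff₀ hv0]
  -- Each term is dominated by an integral over a ball of radius half the separation; for distinct
  -- `k` these balls are disjoint, so the integrals add up to at most the full one.
  have hball : ∀ k, (1 + ‖x j - x k‖ ^ 2) ^ (-b) * v ≤
      ∫ y in Metric.ball (x j - x k) ρ, C * (1 + ‖y‖ ^ 2) ^ (-b) := fun k => by
    have h1 : (volume : Measure (E n)).real (Metric.ball (x j - x k) ρ) = v := by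
      simp only [hv, Measure.real, Measure.addHaar_ball_center volume (x j - x k) ρ]
    rw [mul_comm, ← h1, ← smul_eq_mul, ← setIntegral_const]
    refine setIntegral_mono_on ?_ (hint.const_mul C).integrableOn measurableSet_ball
      fun y hy => one_add_sq_rpow_le hb0 hy
    exact integrableOn_const measure_ball_lt_top.ne
  rw [Finset.sum_mul]
  refine (Finset.sum_le_sum fun k _ => hball k).trans ?_
  rw [← integral_biUnion_finset s (fun _ _ => measurableSet_ball) ?_
    fun _ _ => (hint.const_mul C).integrableOn, ← integral_const_mul]
  · refine setIntegral_le_integral (hint.const_mul C) (Filter.Eventually.of_forall fun y => ?_)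
    positivity
  · intro k _ l _ hkl
    refine Metric.ball_disjoint_ball ?_
    rw [dist_eq_norm, sub_sub_sub_cancel_left]
    linarith [separation_le x hkl.symm]

/-- Schur's test for a symmetric matrix with nonnegative entries. -/
lemma sum_sum_norm_mul_le {A : ℕ → ℕ → ℝ} (hA : ∀ j k, 0 ≤ A j k) (hs : ∀ j k, A j k = A k j)
    {S : ℝ} {s : Finset ℕ} (hS : ∀ j ∈ s, ∑ k ∈ s, A j k ≤ S) (c : ℕ → ℂ) :
    ∑ j ∈ s, ∑ k ∈ s, ‖c j‖ * ‖c k‖ * A j k ≤ S * ∑ j ∈ s, ‖c j‖ ^ 2 := by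
  -- The arithmetic–geometric mean inequality; writing `A k j` in the second half makes both halves
  -- coincide after the sums are exchanged.
  have h1 : ∀ j k, ‖c j‖ * ‖c k‖ * A j k ≤ ‖c j‖ ^ 2 * A j k / 2 + ‖c k‖ ^ 2 * A k j / 2 := by
    intro j k
    rw [← hs j k]
    nlinarith [mul_nonneg (sq_nonneg (‖c j‖ - ‖c k‖)) (hA j k)]
  refine (Finset.sum_le_sum fun j _ => Finset.sum_le_sum fun k _ => h1 j k).trans ?_
  simp only [Finset.sum_add_distrib]
  rw [Finset.sum_comm (f := fun j k => ‖c k‖ ^ 2 * A k j / 2), ← Finset.sum_add_distrib,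
    Finset.mul_sum]
  refine Finset.sum_le_sum fun j hj => ?_
  rw [← Finset.sum_div, add_halves, ← Finset.mul_sum, mul_comm]
  exact mul_le_mul_of_nonneg_right (hS j hj) (sq_nonneg _)

lemma abs_re_conj_mul_le (w z : ℂ) : |(conj w * z).re| ≤ ‖w‖ * ‖z‖ := by
  refine (Complex.abs_re_le_norm _).trans_eq ?_
  rw [norm_mul, RCLike.norm_conj]

lemma sum_sum_re_mul_le {A : ℕ → ℕ → ℝ} (hA : ∀ j k, 0 ≤ A j k) (hs : ∀ j k, A j k = A k j)
    {S : ℝ} {s : Finset ℕ} (hS : ∀ j ∈ s, ∑ k ∈ s, A j k ≤ S) (c : ℕ → ℂ) :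
    |∑ j ∈ s, ∑ k ∈ s, (conj (c j) * c k).re * A j k| ≤ S * ∑ j ∈ s, ‖c j‖ ^ 2 := by
  refine le_trans ?_ (sum_sum_norm_mul_le hA hs hS c)
  refine (Finset.abs_sum_le_sum_abs _ _).trans (Finset.sum_le_sum fun j _ => ?_)
  refine (Finset.abs_sum_le_sum_abs _ _).trans (Finset.sum_le_sum fun k _ => ?_)
  rw [abs_mul, abs_of_nonneg (hA j k)]
  exact mul_le_mul_of_nonneg_right (abs_re_conj_mul_le _ _) (hA j k)

lemma norm_sum_mul_ofReal_sq (s : Finset ℕ) (c : ℕ → ℂ) (u : ℕ → ℝ) :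
    ‖∑ j ∈ s, c j * u j‖ ^ 2 = ∑ j ∈ s, ∑ k ∈ s, (conj (c j) * c k).re * (u j * u k) := by
  have h : ((‖∑ j ∈ s, c j * u j‖ ^ 2 : ℝ) : ℂ) =
      ∑ j ∈ s, ∑ k ∈ s, conj (c j) * c k * ((u j * u k : ℝ) : ℂ) := by
    push_cast
    rw [← Complex.conj_mul', map_sum, Finset.sum_mul_sum]
    refine Finset.sum_congr rfl fun j _ => Finset.sum_congr rfl fun k _ => ?_
    simp only [map_mul, Complex.conj_ofReal]
    ring
  have h2 := congrArg Complex.re h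
  rw [Complex.ofReal_re] at h2
  rw [h2]
  simp only [Complex.re_sum, Complex.re_mul_ofReal]

/-! ### Positive definiteness of Gaussian kernels -/

variable {n : ℕ}

lemma integrable_exp_neg_mul_sq_norm {t : ℝ} (ht : 0 < t) :
    Integrable fun z : E n => Real.exp (-t * ‖z‖ ^ 2) := by
  have h := GaussianFourier.integral_rexp_neg_mul_sq_norm (V := E n) ht
  -- A nonintegrable function has integral `0` by convention, which contradicts the positive value
  -- in `h`.
  by_contra hc
  rw [integral_undef hc] at h
  have : 0 < (Real.pi / t) ^ ((Module.finrank ℝ (E n) : ℝ) / 2) := by positivity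
  linarith

/-- By the parallelogram law the product of two Gaussians is a Gaussian about the midpoint, so
integrating out `z` leaves a constant times `exp (-t ‖x - y‖²)`. -/
lemma exp_mul_exp_eq (t : ℝ) (x y z : E n) :
    Real.exp (-(2 * t) * ‖x - z‖ ^ 2) * Real.exp (-(2 * t) * ‖y - z‖ ^ 2) =
      Real.exp (-t * ‖x - y‖ ^ 2) * Real.exp (-(4 * t) * ‖z - (2 : ℝ)⁻¹ • (x + y)‖ ^ 2) := by
  rw [← Real.exp_add, ← Real.exp_add]
  congr 1
  have h1 := parallelogram_law_with_norm ℝ (x - z) (y - z)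
  have h2 : x - z - (y - z) = x - y := by abel
  have h3 : x - z + (y - z) = (-2 : ℝ) • (z - (2 : ℝ)⁻¹ • (x + y)) := by
    module
  rw [h2, h3, norm_smul, show ‖(-2 : ℝ)‖ = 2 by norm_num] at h1
  linear_combination t * h1

/-- Gaussian kernels are positive semidefinite. -/
lemma sum_sum_gaussian_nonneg {t : ℝ} (ht : 0 < t) (x : ℕ → E n) (s : Finset ℕ) (c : ℕ → ℂ) :
    0 ≤ ∑ j ∈ s, ∑ k ∈ s, (conj (c j) * c k).re * Real.exp (-t * ‖x j - x k‖ ^ 2) := by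
  set I := ∫ z : E n, Real.exp (-(4 * t) * ‖z‖ ^ 2) with hI
  have hI0 : 0 < I := by
    rw [hI, GaussianFourier.integral_rexp_neg_mul_sq_norm (by positivity)]
    positivity
  have hint : ∀ j k, Integrable fun z : E n => (conj (c j) * c k).re *
      (Real.exp (-(2 * t) * ‖x j - z‖ ^ 2) * Real.exp (-(2 * t) * ‖x k - z‖ ^ 2)) := fun j k => by
    simp only [exp_mul_exp_eq]
    exact (((integrable_exp_neg_mul_sq_norm (by positivity)).comp_sub_right _).const_mul
      _).const_mul _
  -- Up to the factor `I`, the quadratic form is the squared `L²` norm of a combination of Gaussians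
  -- of twice the exponent.
  have h : (∑ j ∈ s, ∑ k ∈ s, (conj (c j) * c k).re * Real.exp (-t * ‖x j - x k‖ ^ 2)) * I =
      ∫ z : E n, ‖∑ j ∈ s, c j * (Real.exp (-(2 * t) * ‖x j - z‖ ^ 2) : ℝ)‖ ^ 2 := by
    simp only [norm_sum_mul_ofReal_sq]
    rw [integral_finsetSum _ fun j _ => integrable_finsetSum _ fun k _ => hint j k,
      Finset.sum_mul]
    refine Finset.sum_congr rfl fun j _ => ?_
    rw [integral_finsetSum _ fun k _ => hint j k, Finset.sum_mul]
    refine Finset.sum_congr rfl fun k _ => ?_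
    rw [integral_const_mul, mul_assoc]
    congr 1
    simp only [exp_mul_exp_eq]
    rw [integral_const_mul, hI,
      integral_sub_right_eq_self fun z : E n => Real.exp (-(4 * t) * ‖z‖ ^ 2)]
  have h2 : 0 ≤ ∫ z : E n, ‖∑ j ∈ s, c j * (Real.exp (-(2 * t) * ‖x j - z‖ ^ 2) : ℝ)‖ ^ 2 :=
    integral_nonneg fun _ => sq_nonneg _
  rw [← h] at h2
  exact nonneg_of_mul_nonneg_left h2 hI0

/-- The part `b` of the exponent buys summable decay through `1 + r² ≤ exp (r²)`; the rest gives a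
factor that is small uniformly in `r ≥ d`. -/
lemma exp_neg_mul_sq_le {b d r t : ℝ} (hb : 0 < b) (hd : 0 ≤ d) (hr : d ≤ r) (ht : b ≤ t) :
    Real.exp (-t * r ^ 2) ≤ Real.exp (-(t - b) * d ^ 2) * (1 + r ^ 2) ^ (-b) := by
  have h1 : Real.exp (-b * r ^ 2) ≤ (1 + r ^ 2) ^ (-b) := by
    have h2 : -b * r ^ 2 = r ^ 2 * -b := by ring
    rw [h2, Real.exp_mul]
    refine Real.rpow_le_rpow_of_nonpos (by positivity) ?_ (by linarith)
    linarith [Real.add_one_le_exp (r ^ 2)]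
  have h3 : -t * r ^ 2 = -(t - b) * r ^ 2 + -b * r ^ 2 := by ring
  rw [h3, Real.exp_add]
  refine mul_le_mul (Real.exp_le_exp.mpr ?_) h1 (Real.exp_pos _).le (Real.exp_pos _).le
  nlinarith [pow_le_pow_left₀ hd hr 2]

/-- Narrow Gaussian kernels are uniformly positive definite on a separated sequence. -/
lemma exists_half_sum_le_gaussian {x : ℕ → E n} (hx : 0 < separation x) :
    ∃ T : ℝ, 0 < T ∧ ∀ t, T ≤ t → ∀ (s : Finset ℕ) (c : ℕ → ℂ),
      1 / 2 * ∑ j ∈ s, ‖c j‖ ^ 2 ≤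
        ∑ j ∈ s, ∑ k ∈ s, (conj (c j) * c k).re * Real.exp (-t * ‖x j - x k‖ ^ 2) := by
  set b : ℝ := (n : ℝ) / 2 + 1 with hbdef
  have hb : (n : ℝ) / 2 < b := by linarith
  have hb0 := pos_of_half_lt hb
  obtain ⟨S, hS⟩ := exists_sum_one_add_sq_rpow_le hb hx
  have hS0 : 0 ≤ S := by simpa using hS ∅ 0
  set d := separation x with hd
  -- The threshold makes `(t - b) d² ≥ 2S`, and `S exp (-2S) ≤ 1/2`.
  refine ⟨b + 2 * S / d ^ 2, by positivity, fun t ht s c => ?_⟩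
  have htb : b ≤ t := le_trans (by simp only [le_add_iff_nonneg_right]; positivity) ht
  -- The off-diagonal part: its row sums are at most `1/2`, against the diagonal entries `1`.
  set A : ℕ → ℕ → ℝ := fun j k => if j = k then 0 else Real.exp (-t * ‖x j - x k‖ ^ 2) with hA
  have hA0 : ∀ j k, 0 ≤ A j k := fun j k => by
    simp only [hA]
    split_ifs
    exacts [le_rfl, (Real.exp_pos _).le]
  have hAs : ∀ j k, A j k = A k j := fun j k => by
    simp only [hA, norm_sub_rev (x j) (x k), eq_comm (a := j)]
  have hexp : Real.exp (-(t - b) * d ^ 2) * S ≤ 1 / 2 := by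
    have h1 : 2 * S ≤ (t - b) * d ^ 2 := by
      rw [← div_le_iff₀ (by positivity)]
      linarith
    have h2 : Real.exp (-(t - b) * d ^ 2) ≤ Real.exp (-(2 * S)) :=
      Real.exp_le_exp.mpr (by linarith)
    have h3 := Real.add_one_le_exp (2 * S)
    have h4 : Real.exp (-(2 * S)) * Real.exp (2 * S) = 1 := by
      rw [← Real.exp_add]; simp
    have h5 := Real.exp_pos (-(2 * S))
    nlinarith
  have hrow : ∀ j ∈ s, ∑ k ∈ s, A j k ≤ 1 / 2 := fun j _ => by
    calc ∑ k ∈ s, A j k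
        ≤ ∑ k ∈ s, Real.exp (-(t - b) * d ^ 2) * (1 + ‖x j - x k‖ ^ 2) ^ (-b) := by
          refine Finset.sum_le_sum fun k _ => ?_
          simp only [hA]
          split_ifs with h
          · positivity
          · exact exp_neg_mul_sq_le hb0 hx.le (separation_le x h) htb
      _ ≤ Real.exp (-(t - b) * d ^ 2) * S := by
          rw [← Finset.mul_sum]
          exact mul_le_mul_of_nonneg_left (hS s j) (Real.exp_pos _).le
      _ ≤ _ := hexp
  have hoff := neg_le_of_abs_le (sum_sum_re_mul_le hA0 hAs hrow c)
  have hsplit : ∑ j ∈ s, ∑ k ∈ s, (conj (c j) * c k).re * Real.exp (-t * ‖x j - x k‖ ^ 2) =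
      ∑ j ∈ s, ‖c j‖ ^ 2 + ∑ j ∈ s, ∑ k ∈ s, (conj (c j) * c k).re * A j k := by
    rw [← Finset.sum_add_distrib]
    refine Finset.sum_congr rfl fun j hj => ?_
    have h1 : ‖c j‖ ^ 2 = ∑ k ∈ s, if j = k then ‖c j‖ ^ 2 else 0 := by
      rw [Finset.sum_ite_eq, if_pos hj]
    rw [h1, ← Finset.sum_add_distrib]
    refine Finset.sum_congr rfl fun k _ => ?_
    simp only [hA]
    split_ifs with h
    · subst h
      rw [Complex.conj_mul']
      norm_cast
      simp
    · simp
  rw [hsplit]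
  linarith

/-! ### Inverse multiquadrics as Gamma mixtures of Gaussians -/

lemma integrableOn_rpow_mul_exp {b r : ℝ} (hb : 0 < b) (hr : 0 < r) :
    IntegrableOn (fun u : ℝ => u ^ (b - 1) * Real.exp (-(r * u))) (Set.Ioi 0) := by
  have h := Real.integral_rpow_mul_exp_neg_mul_Ioi hb hr
  by_contra hc
  rw [integral_undef hc] at h
  have h1 := Real.Gamma_pos_of_pos hb
  have : 0 < (1 / r) ^ b * Real.Gamma b := by positivity
  linarith

lemma gamma_mul_one_add_sq_rpow {b : ℝ} (hb : 0 < b) (r : ℝ) :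
    Real.Gamma b * (1 + r ^ 2) ^ (-b) =
      ∫ u in Set.Ioi (0 : ℝ), u ^ (b - 1) * Real.exp (-((1 + r ^ 2) * u)) := by
  rw [Real.integral_rpow_mul_exp_neg_mul_Ioi hb (by positivity), one_div,
    Real.inv_rpow (by positivity), Real.rpow_neg (by positivity), mul_comm]

/-- The Gram matrix of the inverse multiquadrics centred at a separated sequence is bounded
below. -/
lemma exists_le_sum_sum_one_add_sq_rpow {b : ℝ} (hb : 0 < b) {x : ℕ → E n}
    (hx : 0 < separation x) :
    ∃ a : ℝ, 0 < a ∧ ∀ (s : Finset ℕ) (c : ℕ → ℂ), a * ∑ j ∈ s, ‖c j‖ ^ 2 ≤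
      ∑ j ∈ s, ∑ k ∈ s, (conj (c j) * c k).re * (1 + ‖x j - x k‖ ^ 2) ^ (-b) := by
  obtain ⟨T, hT0, hT⟩ := exists_half_sum_le_gaussian hx
  have hG := Real.Gamma_pos_of_pos hb
  have hbase : IntegrableOn (fun u : ℝ => u ^ (b - 1) * Real.exp (-(1 * u))) (Set.Ioi 0) :=
    integrableOn_rpow_mul_exp hb one_pos
  set κ := ∫ u in Set.Ioi T, u ^ (b - 1) * Real.exp (-(1 * u)) with hκ
  have hκ0 : 0 < κ := by
    have hpos : ∀ u ∈ Set.Ioi T, 0 < u ^ (b - 1) * Real.exp (-(1 * u)) := fun u hu =>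
      mul_pos (Real.rpow_pos_of_pos (hT0.trans hu) _) (Real.exp_pos _)
    rw [hκ, setIntegral_pos_iff_support_of_nonneg_ae
      ((ae_restrict_mem measurableSet_Ioi).mono fun u hu => (hpos u hu).le)
      (hbase.mono_set (Set.Ioi_subset_Ioi hT0.le))]
    rw [Set.inter_eq_self_of_subset_right fun u hu => Function.mem_support.mpr (hpos u hu).ne']
    simp
  -- The mixture weight carries mass `κ` on `u > T`, where each Gaussian form is at least half of `∑
  -- ‖c j‖²`; the forms with `u ≤ T` are nonnegative and are dropped.
  refine ⟨κ / (2 * Real.Gamma b), by positivity, fun s c => ?_⟩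
  set N := ∑ j ∈ s, ‖c j‖ ^ 2 with hN
  set Q : ℝ → ℝ := fun u =>
    ∑ j ∈ s, ∑ k ∈ s, (conj (c j) * c k).re * Real.exp (-u * ‖x j - x k‖ ^ 2) with hQ
  have hint : ∀ j k, IntegrableOn (fun u : ℝ => (conj (c j) * c k).re *
      (u ^ (b - 1) * Real.exp (-((1 + ‖x j - x k‖ ^ 2) * u)))) (Set.Ioi 0) := fun j k =>
    (integrableOn_rpow_mul_exp hb (by positivity)).const_mul _
  have hterm : ∀ u : ℝ, u ^ (b - 1) * Real.exp (-(1 * u)) * Q u = ∑ j ∈ s, ∑ k ∈ s,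
      (conj (c j) * c k).re * (u ^ (b - 1) * Real.exp (-((1 + ‖x j - x k‖ ^ 2) * u))) := by
    intro u
    simp only [hQ, Finset.mul_sum]
    refine Finset.sum_congr rfl fun j _ => Finset.sum_congr rfl fun k _ => ?_
    have : -((1 + ‖x j - x k‖ ^ 2) * u) = -(1 * u) + -u * ‖x j - x k‖ ^ 2 := by ring
    rw [this, Real.exp_add]
    ring
  have hQint : IntegrableOn (fun u : ℝ => u ^ (b - 1) * Real.exp (-(1 * u)) * Q u)
      (Set.Ioi 0) := by
    simp only [hterm]
    exact integrable_finsetSum _ fun j _ => integrable_finsetSum _ fun k _ => hint j k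
  have heq : Real.Gamma b * ∑ j ∈ s, ∑ k ∈ s,
      (conj (c j) * c k).re * (1 + ‖x j - x k‖ ^ 2) ^ (-b) =
      ∫ u in Set.Ioi (0 : ℝ), u ^ (b - 1) * Real.exp (-(1 * u)) * Q u := by
    simp only [hterm]
    rw [integral_finsetSum _ fun j _ => integrable_finsetSum _ fun k _ => hint j k,
      Finset.mul_sum]
    refine Finset.sum_congr rfl fun j _ => ?_
    rw [integral_finsetSum _ fun k _ => hint j k, Finset.mul_sum]
    refine Finset.sum_congr rfl fun k _ => ?_
    rw [integral_const_mul, ← gamma_mul_one_add_sq_rpow hb]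
    ring
  have hlow : κ * (1 / 2 * N) ≤
      ∫ u in Set.Ioi (0 : ℝ), u ^ (b - 1) * Real.exp (-(1 * u)) * Q u := by
    rw [hκ, ← integral_mul_const]
    refine le_trans (setIntegral_mono_on
      ((hbase.mono_set (Set.Ioi_subset_Ioi hT0.le)).mul_const _)
      (hQint.mono_set (Set.Ioi_subset_Ioi hT0.le)) measurableSet_Ioi fun u hu => ?_)
      (setIntegral_mono_set hQint ?_ (Set.Ioi_subset_Ioi hT0.le).eventuallyLE)
    · exact mul_le_mul_of_nonneg_left (hT u hu.le s c)
        (mul_nonneg (Real.rpow_nonneg (hT0.trans hu).le _) (Real.exp_pos _).le)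
    · filter_upwards [ae_restrict_mem measurableSet_Ioi] with u hu
      exact mul_nonneg (mul_nonneg (Real.rpow_nonneg (le_of_lt hu) _) (Real.exp_pos _).le)
        (sum_sum_gaussian_nonneg hu x s c)
  rw [← heq] at hlow
  rw [div_mul_eq_mul_div, div_le_iff₀ (by positivity)]
  linarith

/-- The Gram matrix of the inverse multiquadrics centred at a separated sequence is bounded
above. -/
lemma exists_sum_sum_one_add_sq_rpow_le {b : ℝ} (hb : (n : ℝ) / 2 < b) {x : ℕ → E n}
    (hx : 0 < separation x) :
    ∃ S : ℝ, ∀ (s : Finset ℕ) (c : ℕ → ℂ),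
      ∑ j ∈ s, ∑ k ∈ s, (conj (c j) * c k).re * (1 + ‖x j - x k‖ ^ 2) ^ (-b) ≤
        S * ∑ j ∈ s, ‖c j‖ ^ 2 := by
  obtain ⟨S, hS⟩ := exists_sum_one_add_sq_rpow_le hb hx
  refine ⟨S, fun s c => (le_abs_self _).trans (sum_sum_re_mul_le (fun j k => by positivity)
    (fun j k => by rw [norm_sub_rev]) (fun j _ => hS s j) c)⟩

end GramMatrix

/-! ### The Fourier transform of the inverse multiquadric -/

section Transform

/-- The substitution `u = (z/2) e^{-s}` turns the exponent into `-z cosh s`. -/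
lemma integral_rpow_mul_exp_eq_besselK (a : ℝ) {z : ℝ} (hz : 0 < z) :
    ∫ u in Set.Ioi (0 : ℝ), u ^ (a - 1) * Real.exp (-u - z ^ 2 / (4 * u)) =
      2 * (z / 2) ^ a * besselK a z := by
  have himg : (fun s : ℝ => z / 2 * Real.exp (-s)) '' Set.univ = Set.Ioi 0 := by
    ext u
    simp only [Set.image_univ, Set.mem_range, Set.mem_Ioi]
    refine ⟨?_, fun hu => ⟨-Real.log (u / (z / 2)), ?_⟩⟩
    · rintro ⟨s, rfl⟩
      positivity
    · rw [neg_neg, Real.exp_log (by positivity)]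
      field_simp
  have hderiv : ∀ s ∈ Set.univ, HasDerivWithinAt (fun s : ℝ => z / 2 * Real.exp (-s))
      (z / 2 * (Real.exp (-s) * -1)) Set.univ s := fun s _ =>
    (((hasDerivAt_neg s).exp).const_mul (z / 2)).hasDerivWithinAt
  have hinj : Set.InjOn (fun s : ℝ => z / 2 * Real.exp (-s)) Set.univ := fun s _ t _ h => by
    have h1 := mul_left_cancel₀ (by positivity) h
    simpa using h1
  rw [← himg, integral_image_eq_integral_abs_deriv_smul MeasurableSet.univ hderiv hinj,
    setIntegral_univ, besselK, ← mul_assoc, ← integral_const_mul]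
  refine integral_congr_ae (Filter.Eventually.of_forall fun s => ?_)
  have he : 0 < Real.exp (-s) := Real.exp_pos _
  have hu : 0 < z / 2 * Real.exp (-s) := by positivity
  have h1 : |z / 2 * (Real.exp (-s) * -1)| = z / 2 * Real.exp (-s) := by
    rw [← mul_assoc, mul_neg_one, abs_neg, abs_of_pos hu]
  have h2 : -(z / 2 * Real.exp (-s)) - z ^ 2 / (4 * (z / 2 * Real.exp (-s))) =
      -z * Real.cosh s := by
    rw [Real.cosh_eq, Real.exp_neg]
    field_simp
    ring
  have h3 : (z / 2 * Real.exp (-s)) * (z / 2 * Real.exp (-s)) ^ (a - 1) =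
      (z / 2) ^ a * Real.exp (-(a * s)) := by
    rw [mul_comm, ← Real.rpow_add_one hu.ne', sub_add_cancel,
      Real.mul_rpow (by positivity) he.le, ← Real.exp_mul]
    congr 2
    ring
  simp only [smul_eq_mul]
  rw [h1, h2, ← mul_assoc, h3, sub_eq_add_neg, Real.exp_add]
  ring

variable {n : ℕ} {b : ℝ}

/-- The integrand of the subordination formula for the Fourier transform of `(1 + |x|²)^{-b}`. -/
noncomputable def subordination (n : ℕ) (b : ℝ) (w : E n) (u : ℝ) : ℝ :=
  u ^ (b - 1) * Real.exp (-(1 * u)) *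
    ((Real.pi / u) ^ ((n : ℝ) / 2) * Real.exp (-(Real.pi ^ 2 / u) * ‖w‖ ^ 2))

lemma fourier_real_gaussian {u : ℝ} (hu : 0 < u) (w : E n) :
    𝓕 (fun v : E n => ((Real.exp (-u * ‖v‖ ^ 2) : ℝ) : ℂ)) w =
      (((Real.pi / u) ^ ((n : ℝ) / 2) * Real.exp (-(Real.pi ^ 2 / u) * ‖w‖ ^ 2) : ℝ) : ℂ) := by
  have h := fourier_gaussian_innerProductSpace (V := E n) (b := (u : ℂ))
    (by simpa using hu) w
  rw [finrank_euclideanSpace_fin] at h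
  have h1 : (fun v : E n => ((Real.exp (-u * ‖v‖ ^ 2) : ℝ) : ℂ)) =
      fun v : E n => Complex.exp (-(u : ℂ) * ‖v‖ ^ 2) := by
    funext v
    push_cast
    rfl
  rw [h1, h, Complex.ofReal_mul, Complex.ofReal_cpow (by positivity)]
  push_cast
  congr 2
  ring

/-- The transform of each Gaussian has integral `1`, the value of the Gaussian at the origin, so
integrating first in `w` leaves the convergent Gamma integral. -/
lemma integrable_subordination (hb : 0 < b) :
    Integrable (fun p : E n × ℝ => subordination n b p.1 p.2)
      (volume.prod (volume.restrict (Set.Ioi 0))) := by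
  have hmeas : Measurable fun p : E n × ℝ => subordination n b p.1 p.2 := by
    unfold subordination
    fun_prop
  have hi : ∀ u : ℝ, 0 < u → ∫ w : E n, subordination n b w u =
      u ^ (b - 1) * Real.exp (-(1 * u)) := fun u hu => by
    simp only [subordination]
    rw [integral_const_mul, integral_const_mul,
      GaussianFourier.integral_rexp_neg_mul_sq_norm (by positivity), finrank_euclideanSpace_fin,
      ← Real.mul_rpow (by positivity) (by positivity)]
    have h : Real.pi / u * (Real.pi / (Real.pi ^ 2 / u)) = 1 := by
      field_simp
    rw [h, Real.one_rpow, mul_one]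
  rw [integrable_prod_iff' hmeas.aestronglyMeasurable]
  constructor
  · filter_upwards [ae_restrict_mem measurableSet_Ioi] with u hu
    exact ((integrable_exp_neg_mul_sq_norm (div_pos (by positivity) hu)).const_mul _).const_mul _
  · refine (integrableOn_rpow_mul_exp hb one_pos).congr ?_
    filter_upwards [ae_restrict_mem measurableSet_Ioi] with u hu
    have hu' : 0 < u := hu
    rw [← hi u hu]
    refine integral_congr_ae (Filter.Eventually.of_forall fun w => ?_)
    simp only [subordination]
    rw [Real.norm_of_nonneg (by positivity)]

lemma integrable_rpow_mul_exp_prod (hb : (n : ℝ) / 2 < b) :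
    Integrable (fun p : E n × ℝ => p.2 ^ (b - 1) * Real.exp (-((1 + ‖p.1‖ ^ 2) * p.2)))
      (volume.prod (volume.restrict (Set.Ioi 0))) := by
  have hb0 := pos_of_half_lt hb
  have hmeas : Measurable
      fun p : E n × ℝ => p.2 ^ (b - 1) * Real.exp (-((1 + ‖p.1‖ ^ 2) * p.2)) := by
    fun_prop
  rw [integrable_prod_iff hmeas.aestronglyMeasurable]
  refine ⟨Filter.Eventually.of_forall fun v =>
    integrableOn_rpow_mul_exp (r := 1 + ‖v‖ ^ 2) hb0 (by positivity), ?_⟩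
  refine ((integrable_one_add_sq_rpow hb).const_mul (Real.Gamma b)).congr
    (Filter.Eventually.of_forall fun v => ?_)
  refine (gamma_mul_one_add_sq_rpow hb0 ‖v‖).trans
    (setIntegral_congr_fun measurableSet_Ioi fun u hu => ?_)
  simp only
  rw [Real.norm_of_nonneg (mul_nonneg (Real.rpow_nonneg (le_of_lt hu) _) (Real.exp_pos _).le)]

/-- The Gamma integral is inserted and Fubini lets the transform act on each Gaussian; the phase has
modulus one, so absolute convergence comes from `integrable_rpow_mul_exp_prod`. -/
lemma gamma_mul_fourier_invMultiquadric (hb : (n : ℝ) / 2 < b) (w : E n) :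
    (Real.Gamma b : ℂ) * 𝓕 (invMultiquadric n b) w =
      ((∫ u in Set.Ioi (0 : ℝ), subordination n b w u : ℝ) : ℂ) := by
  have hb0 := pos_of_half_lt hb
  have h1 : (Real.Gamma b : ℂ) * 𝓕 (invMultiquadric n b) w =
      ∫ v : E n, ∫ u in Set.Ioi (0 : ℝ), Complex.exp (↑(-2 * Real.pi * ⟪v, w⟫_ℝ) * Complex.I) *
        ((u ^ (b - 1) * Real.exp (-((1 + ‖v‖ ^ 2) * u)) : ℝ) : ℂ) := by
    rw [Real.fourier_eq', ← integral_const_mul]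
    refine integral_congr_ae (Filter.Eventually.of_forall fun v => ?_)
    simp only [invMultiquadric, smul_eq_mul]
    rw [integral_const_mul, integral_complex_ofReal, ← gamma_mul_one_add_sq_rpow hb0]
    push_cast
    ring
  rw [h1, integral_integral_swap, ← integral_complex_ofReal]
  · refine setIntegral_congr_fun measurableSet_Ioi fun u hu => ?_
    simp only [subordination]
    rw [Complex.ofReal_mul, ← fourier_real_gaussian hu, Real.fourier_eq', ← integral_const_mul]
    refine integral_congr_ae (Filter.Eventually.of_forall fun v => ?_)
    have h2 : -((1 + ‖v‖ ^ 2) * u) = -(1 * u) + -u * ‖v‖ ^ 2 := by ring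
    simp only [smul_eq_mul]
    rw [h2, Real.exp_add]
    push_cast
    ring
  · refine ((integrable_rpow_mul_exp_prod hb).ofReal (𝕜 := ℂ)).bdd_mul (c := 1) ?_ ?_
    · apply Continuous.aestronglyMeasurable
      fun_prop
    · refine Filter.Eventually.of_forall fun p => ?_
      rw [Complex.norm_exp_ofReal_mul_I]

/-- With `z = 2π‖w‖` the factor `u^{-n/2}` lowers the order from `b` to `b - n/2`, and the Bessel
integral appears. It needs `z > 0`, hence `w ≠ 0`. -/
lemma setIntegral_subordination (w : E n) (hw : w ≠ 0) (hb : 0 < b) :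
    ∫ u in Set.Ioi (0 : ℝ), subordination n b w u =
      Real.Gamma b * ((2 * Real.pi) ^ n * besselPotential n b ‖(2 * Real.pi) • w‖) := by
  set z := ‖(2 * Real.pi) • w‖ with hz
  have hz' : z = 2 * Real.pi * ‖w‖ := by
    rw [hz, norm_smul, Real.norm_of_nonneg (by positivity)]
  have hz0 : 0 < z := by
    have := norm_pos_iff.mpr hw
    rw [hz']
    positivity
  set a := b - (n : ℝ) / 2 with ha
  have h1 : ∫ u in Set.Ioi (0 : ℝ), subordination n b w u =
      Real.pi ^ ((n : ℝ) / 2) *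
        ∫ u in Set.Ioi (0 : ℝ), u ^ (a - 1) * Real.exp (-u - z ^ 2 / (4 * u)) := by
    rw [← integral_const_mul]
    refine setIntegral_congr_fun measurableSet_Ioi fun u hu => ?_
    have hu' : 0 < u := hu
    simp only [subordination]
    have h2 : -u - z ^ 2 / (4 * u) = -(1 * u) + -(Real.pi ^ 2 / u) * ‖w‖ ^ 2 := by
      rw [hz']
      field_simp
      ring
    have h3 : u ^ (a - 1) = u ^ (b - 1) / u ^ ((n : ℝ) / 2) := by
      rw [← Real.rpow_sub hu', ha]
      congr 1
      ring
    rw [h2, Real.exp_add, h3, Real.div_rpow (by positivity) hu'.le]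
    ring
  have hG := Real.Gamma_pos_of_pos hb
  rw [h1, integral_rpow_mul_exp_eq_besselK a hz0, besselPotential, ← ha,
    Real.div_rpow hz0.le (by norm_num), ← Real.rpow_natCast, Real.mul_rpow (by norm_num)
    Real.pi_pos.le]
  have h4 : (2 : ℝ) ^ (b - 1 + (n : ℝ) / 2) = 2 ^ (n : ℝ) * 2 ^ a / 2 := by
    rw [← Real.rpow_add (by norm_num), ← Real.rpow_sub_one (by norm_num), ha]
    congr 1
    ring
  have h5 : Real.pi ^ (n : ℝ) = Real.pi ^ ((n : ℝ) / 2) * Real.pi ^ ((n : ℝ) / 2) := by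
    rw [← Real.rpow_add Real.pi_pos, add_halves]
  rw [h4, h5]
  field_simp

/-- The Fourier transform of the inverse multiquadric, in the normalization
`∫ e^{-2πi w·x} f(x) dx`. -/
noncomputable def spectralDensity (n : ℕ) (b : ℝ) (w : E n) : ℝ :=
  (2 * Real.pi) ^ n * besselPotential n b ‖(2 * Real.pi) • w‖

lemma fourier_invMultiquadric (hb : (n : ℝ) / 2 < b) {w : E n} (hw : w ≠ 0) :
    𝓕 (invMultiquadric n b) w = (spectralDensity n b w : ℂ) := by
  have hb0 := pos_of_half_lt hb
  have h := gamma_mul_fourier_invMultiquadric hb w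
  rw [setIntegral_subordination w hw hb0, Complex.ofReal_mul] at h
  refine mul_left_cancel₀ ?_ h
  exact Complex.ofReal_ne_zero.mpr (Real.Gamma_pos_of_pos hb0).ne'

lemma ae_fourier_invMultiquadric (hn : 0 < n) (hb : (n : ℝ) / 2 < b) :
    𝓕 (invMultiquadric n b) =ᵐ[volume] fun w => (spectralDensity n b w : ℂ) := by
  have : Nonempty (Fin n) := ⟨⟨0, hn⟩⟩
  filter_upwards [Measure.ae_ne volume (0 : E n)] with w hw
  exact fourier_invMultiquadric hb hw

lemma measurable_spectralDensity (n : ℕ) (b : ℝ) : Measurable (spectralDensity n b) :=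
  ((measurable_besselPotential n b).comp (by fun_prop)).const_mul _

lemma spectralDensity_nonneg (hb : 0 < b) (w : E n) : 0 ≤ spectralDensity n b w :=
  mul_nonneg (by positivity)
    (mul_nonneg (besselPotential_const_pos n hb).le (matern_nonneg _ (norm_nonneg _)))

lemma spectralDensity_pos (hb : 0 < b) {w : E n} (hw : w ≠ 0) : 0 < spectralDensity n b w := by
  have h : 0 < ‖(2 * Real.pi) • w‖ := norm_pos_iff.mpr (smul_ne_zero (by positivity) hw)
  exact mul_pos (by positivity) (besselPotential_pos n hb h)

lemma ae_spectralDensity_pos (hn : 0 < n) (hb : 0 < b) :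
    ∀ᵐ w : E n, 0 < spectralDensity n b w := by
  have : Nonempty (Fin n) := ⟨⟨0, hn⟩⟩
  filter_upwards [Measure.ae_ne volume (0 : E n)] with w hw
  exact spectralDensity_pos hb hw

lemma integrable_spectralDensity (hn : 0 < n) (hb : (n : ℝ) / 2 < b) :
    Integrable (spectralDensity n b) := by
  have hb0 := pos_of_half_lt hb
  have : Nonempty (Fin n) := ⟨⟨0, hn⟩⟩
  refine ((integrable_subordination hb0).integral_prod_left.const_mul (Real.Gamma b)⁻¹).congr ?_
  filter_upwards [Measure.ae_ne volume (0 : E n)] with w hw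
  rw [setIntegral_subordination w hw hb0, inv_mul_cancel_left₀ (Real.Gamma_pos_of_pos hb0).ne']
  rfl

lemma continuous_invMultiquadric (n : ℕ) (b : ℝ) : Continuous (invMultiquadric n b) := by
  refine Complex.continuous_ofReal.comp (Continuous.rpow_const (by fun_prop) fun x => ?_)
  exact Or.inl (by positivity)

lemma norm_invMultiquadric (n : ℕ) (b : ℝ) (x : E n) :
    ‖invMultiquadric n b x‖ = (1 + ‖x‖ ^ 2) ^ (-b) := by
  rw [invMultiquadric, Complex.norm_real, Real.norm_of_nonneg (by positivity)]

lemma integrable_invMultiquadric (hb : (n : ℝ) / 2 < b) : Integrable (invMultiquadric n b) :=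
  (integrable_one_add_sq_rpow hb).ofReal

lemma memLp_two_invMultiquadric (hb : (n : ℝ) / 2 < b) :
    MemLp (invMultiquadric n b) 2 (volume : Measure (E n)) := by
  rw [memLp_two_iff_integrable_sq_norm (continuous_invMultiquadric n b).aestronglyMeasurable]
  have h := integrable_one_add_sq_rpow (n := n) (b := 2 * b)
    (by linarith [pos_of_half_lt hb])
  refine h.congr (Filter.Eventually.of_forall fun x => ?_)
  simp only [norm_invMultiquadric]
  rw [← Real.rpow_mul_natCast (by positivity)]
  congr 1
  push_cast
  ring

/-- A Fourier transform is bounded by the `L¹` norm. -/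
lemma exists_spectralDensity_le (hn : 0 < n) (hb : (n : ℝ) / 2 < b) :
    ∃ M : ℝ, ∀ᵐ w : E n, spectralDensity n b w ≤ M := by
  refine ⟨∫ x, ‖invMultiquadric n b x‖, ?_⟩
  filter_upwards [ae_fourier_invMultiquadric hn hb] with w hw
  have h := VectorFourier.norm_fourierIntegral_le_integral_norm Real.fourierChar volume
    (innerₗ (E n)) (invMultiquadric n b) w
  have h2 : ‖𝓕 (invMultiquadric n b) w‖ ≤ ∫ x, ‖invMultiquadric n b x‖ := h
  rw [hw, Complex.norm_real] at h2
  exact (le_abs_self _).trans h2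

end Transform

/-! ### The native space in the variable `w = ξ/(2π)` -/

section NativeSpace

variable {n : ℕ} {b : ℝ}

lemma l2Fourier_two_pi_smul {f : E n → ℂ} (hf : MemLp f 2 (volume : Measure (E n))) (w : E n) :
    l2Fourier f ((2 * Real.pi) • w) = (𝓕 (hf.toLp f) : Lp ℂ 2 (volume : Measure (E n))) w := by
  rw [l2Fourier_of hf]
  simp only [smul_smul]
  rw [inv_mul_cancel₀ (by positivity), one_smul]

lemma mem_kSpace_iff (hb : 0 < b) {f : E n → ℂ} (hf : MemLp f 2 (volume : Measure (E n))) :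
    f ∈ kSpace n (b - (n : ℝ) / 2) ↔ Continuous f ∧ Integrable fun w : E n =>
      ‖(𝓕 (hf.toLp f) : Lp ℂ 2 (volume : Measure (E n))) w‖ ^ 2 / spectralDensity n b w := by
  set C : ℝ := (2 * Real.pi) ^ n * (1 / ((2 : ℝ) ^ (b - 1 + (n : ℝ) / 2) *
    Real.pi ^ ((n : ℝ) / 2) * Real.Gamma b)) with hC
  have hC0 : C ≠ 0 := (mul_pos (by positivity) (besselPotential_const_pos n hb)).ne'
  have h : (Integrable fun w : E n =>
      ‖(𝓕 (hf.toLp f) : Lp ℂ 2 (volume : Measure (E n))) w‖ ^ 2 / spectralDensity n b w) ↔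
      Integrable (fun ξ : E n => ‖l2Fourier f ξ‖ ^ 2 /
        (besselK (b - (n : ℝ) / 2) ‖ξ‖ * ‖ξ‖ ^ (b - (n : ℝ) / 2))) := by
    refine Iff.trans ?_ (integrable_comp_smul_iff volume _ (R := 2 * Real.pi) (by positivity))
    rw [← integrable_const_mul_iff hC0.isUnit]
    refine integrable_congr (Filter.Eventually.of_forall fun w => ?_)
    simp only [l2Fourier_two_pi_smul hf, spectralDensity, besselPotential]
    rw [← mul_assoc ((2 * Real.pi) ^ n), ← hC, ← mul_div_assoc, mul_div_mul_left _ _ hC0]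
  rw [h]
  exact ⟨fun h => ⟨h.1, h.2.2⟩, fun h => ⟨h.1, hf, h.2⟩⟩

/-- The factor `(2π)^{-2n}` is used up exactly: one `(2π)^{-n}` is the Jacobian of `ξ = 2πw`, the
other sits in the spectral density. -/
lemma innerForm_eq {f g : E n → ℂ} (hf : MemLp f 2 (volume : Measure (E n)))
    (hg : MemLp g 2 (volume : Measure (E n))) :
    innerForm n b f g = ∫ w : E n, (𝓕 (hf.toLp f) : Lp ℂ 2 (volume : Measure (E n))) w *
      conj ((𝓕 (hg.toLp g) : Lp ℂ 2 (volume : Measure (E n))) w) / spectralDensity n b w := by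
  have h1 : ∀ w : E n, (𝓕 (hf.toLp f) : Lp ℂ 2 (volume : Measure (E n))) w *
      conj ((𝓕 (hg.toLp g) : Lp ℂ 2 (volume : Measure (E n))) w) / spectralDensity n b w =
      ((((2 * Real.pi) ^ n)⁻¹ : ℝ) : ℂ) * innerIntegrand n b f g ((2 * Real.pi) • w) := fun w => by
    rw [innerIntegrand, l2Fourier_two_pi_smul hf, l2Fourier_two_pi_smul hg, spectralDensity]
    simp only [div_eq_mul_inv]
    push_cast
    rw [mul_inv]
    ring
  simp only [h1]
  rw [integral_const_mul, Measure.integral_comp_smul, innerForm, finrank_euclideanSpace_fin,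
    abs_of_pos (by positivity), Complex.real_smul, ← mul_assoc, ← Complex.ofReal_mul, ← mul_inv,
    ← pow_add, two_mul n]

/-- With `r = |f̂|` one has `r ≤ r²/p + p`, and both summands are integrable. This makes pointwise
inversion available. -/
lemma integrable_fourier_toLp (hn : 0 < n) (hb : (n : ℝ) / 2 < b) {f : E n → ℂ}
    (hf : MemLp f 2 (volume : Measure (E n)))
    (hi : Integrable fun w : E n =>
      ‖(𝓕 (hf.toLp f) : Lp ℂ 2 (volume : Measure (E n))) w‖ ^ 2 / spectralDensity n b w) :
    Integrable (𝓕 (hf.toLp f) : Lp ℂ 2 (volume : Measure (E n))) := by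
  refine (hi.add (integrable_spectralDensity hn hb)).mono' (Lp.aestronglyMeasurable _) ?_
  filter_upwards [ae_spectralDensity_pos hn (pos_of_half_lt hb)] with w hw
  simp only [Pi.add_apply]
  set p := spectralDensity n b w
  set r := ‖(𝓕 (hf.toLp f) : Lp ℂ 2 (volume : Measure (E n))) w‖
  have h : r ^ 2 / p + p = (r ^ 2 + p ^ 2) / p := by field_simp
  rw [h, le_div_iff₀ hw]
  nlinarith [sq_nonneg (r - p), sq_nonneg r, sq_nonneg p]

/-- Inversion in `L²` holds almost everywhere; continuity of both sides makes it hold at every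
point. -/
lemma fourierInv_fourier_toLp {f : E n → ℂ} (hc : Continuous f)
    (hf : MemLp f 2 (volume : Measure (E n)))
    (hi : Integrable (𝓕 (hf.toLp f) : Lp ℂ 2 (volume : Measure (E n)))) :
    𝓕⁻ ((𝓕 (hf.toLp f) : Lp ℂ 2 (volume : Measure (E n))) : E n → ℂ) = f := by
  refine (Continuous.ae_eq_iff_eq volume (continuous_fourierInv hi) hc).mp ?_
  refine (fourierInv_toLp_ae_eq hi (Lp.memLp _)).symm.trans ?_
  rw [Lp.toLp_coeFn, FourierTransform.fourierInv_fourier_eq]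
  exact hf.coeFn_toLp

lemma fourier_comp_sub_right (f : E n → ℂ) (y w : E n) :
    𝓕 (fun x => f (x - y)) w =
      Complex.exp (↑(-(2 * Real.pi * ⟪y, w⟫_ℝ)) * Complex.I) * 𝓕 f w := by
  rw [Real.fourier_eq', Real.fourier_eq', ← integral_const_mul,
    ← integral_add_right_eq_self _ y]
  refine integral_congr_ae (Filter.Eventually.of_forall fun x => ?_)
  simp only [add_sub_cancel_right, smul_eq_mul, inner_add_left]
  rw [← mul_assoc, ← Complex.exp_add]
  congr 2
  push_cast
  ring

lemma memLp_translate (hb : (n : ℝ) / 2 < b) (y : E n) :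
    MemLp (fun x => invMultiquadric n b (x - y)) 2 (volume : Measure (E n)) :=
  (memLp_two_invMultiquadric hb).comp_measurePreserving (measurePreserving_sub_right volume y)

lemma fourier_translate_ae_eq (hn : 0 < n) (hb : (n : ℝ) / 2 < b) (y : E n) :
    (𝓕 ((memLp_translate hb y).toLp _) : Lp ℂ 2 (volume : Measure (E n))) =ᵐ[volume] fun w =>
      Complex.exp (↑(-(2 * Real.pi * ⟪y, w⟫_ℝ)) * Complex.I) * spectralDensity n b w := by
  refine (fourier_toLp_ae_eq ((integrable_invMultiquadric hb).comp_sub_right y) _).trans ?_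
  filter_upwards [ae_fourier_invMultiquadric hn hb] with w hw
  rw [fourier_comp_sub_right, hw]

/-- A translation only changes the phase of the transform, so the weighted density is `p²/p = p`. -/
lemma translate_mem_kSpace (hn : 0 < n) (hb : (n : ℝ) / 2 < b) (y : E n) :
    (fun x => invMultiquadric n b (x - y)) ∈ kSpace n (b - (n : ℝ) / 2) := by
  have hb0 := pos_of_half_lt hb
  rw [mem_kSpace_iff hb0 (memLp_translate hb y)]
  refine ⟨(continuous_invMultiquadric n b).comp (by fun_prop), ?_⟩
  refine (integrable_spectralDensity hn hb).congr ?_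
  filter_upwards [fourier_translate_ae_eq hn hb y, ae_spectralDensity_pos hn hb0] with w h1 h2
  rw [h1, norm_mul, Complex.norm_exp_ofReal_mul_I, one_mul, Complex.norm_real,
    Real.norm_of_nonneg h2.le, sq, mul_div_cancel_right₀ _ h2.ne']

/-! ### Reproducing property, completeness and the Riesz sequence -/

namespace KHilbert

variable {hn : 0 < n} {hb : (n : ℝ) / 2 < b}

/-- The translate `φ_b(· - y)` of the inverse multiquadric. -/
noncomputable def translate (hn : 0 < n) (hb : (n : ℝ) / 2 < b) (y : E n) : KHilbert n b hn hb :=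
  ⟨fun x => invMultiquadric n b (x - y), translate_mem_kSpace hn hb y⟩

lemma toFun_translate (y : E n) :
    toFun (translate hn hb y) = fun x => invMultiquadric n b (x - y) := rfl

/-- The transform of the translate is a phase times `p`; the weight cancels `p`, and what remains is
the inversion integral of `f` at `y`. -/
lemma inner_translate (y : E n) (f : KHilbert n b hn hb) :
    ⟪translate hn hb y, f⟫_ℂ = toFun f y := by
  have hb0 := pos_of_half_lt hb
  obtain ⟨hc, hf, -⟩ := toFun_mem f
  have hi := ((mem_kSpace_iff hb0 hf).mp (toFun_mem f)).2
  have hL := integrable_fourier_toLp hn hb hf hi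
  rw [inner_eq, toFun_translate, innerForm_eq hf (memLp_translate hb y)]
  conv_rhs => rw [← fourierInv_fourier_toLp hc hf hL]
  rw [Real.fourierInv_eq']
  refine integral_congr_ae ?_
  filter_upwards [fourier_translate_ae_eq hn hb y, ae_spectralDensity_pos hn hb0] with w h1 h2
  have h3 : (spectralDensity n b w : ℂ) ≠ 0 := Complex.ofReal_ne_zero.mpr h2.ne'
  rw [h1, map_mul, Complex.conj_ofReal, ← Complex.exp_conj, map_mul, Complex.conj_ofReal,
    Complex.conj_I, ← mul_assoc, mul_div_cancel_right₀ _ h3, smul_eq_mul, mul_comm,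
    real_inner_comm]
  congr 2
  push_cast
  ring

lemma norm_sq_eq (f : KHilbert n b hn hb) (hf : MemLp (toFun f) 2 (volume : Measure (E n))) :
    ‖f‖ ^ 2 = ∫ w : E n, ‖(𝓕 (hf.toLp (toFun f)) : Lp ℂ 2 (volume : Measure (E n))) w‖ ^ 2 /
      spectralDensity n b w := by
  have h : ((‖f‖ ^ 2 : ℝ) : ℂ) = _ :=
    (Complex.ofReal_pow _ _).trans (inner_self_eq_norm_sq_to_K (𝕜 := ℂ) f).symm
  rw [inner_eq, innerForm_eq hf hf] at h
  rw [← Complex.ofReal_inj, h, ← integral_complex_ofReal]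
  refine integral_congr_ae (Filter.Eventually.of_forall fun w => ?_)
  simp only
  rw [Complex.mul_conj']
  push_cast
  rfl

/-- The quotient of the Fourier transform by the square root of the spectral density. -/
noncomputable def whitened (f : KHilbert n b hn hb) (w : E n) : ℂ :=
  (𝓕 ((toFun_mem f).2.1.toLp (toFun f)) : Lp ℂ 2 (volume : Measure (E n))) w /
    (√(spectralDensity n b w) : ℝ)

lemma norm_whitened_sq (f : KHilbert n b hn hb) (w : E n) :
    ‖whitened f w‖ ^ 2 =
      ‖(𝓕 ((toFun_mem f).2.1.toLp (toFun f)) : Lp ℂ 2 (volume : Measure (E n))) w‖ ^ 2 /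
        spectralDensity n b w := by
  rw [whitened, norm_div, div_pow, Complex.norm_real, Real.norm_of_nonneg (Real.sqrt_nonneg _),
    Real.sq_sqrt (spectralDensity_nonneg (pos_of_half_lt hb) w)]

lemma memLp_whitened (f : KHilbert n b hn hb) :
    MemLp (whitened f) 2 (volume : Measure (E n)) := by
  have hmeas : AEStronglyMeasurable (whitened f) (volume : Measure (E n)) := by
    refine AEStronglyMeasurable.div₀ (Lp.aestronglyMeasurable _) ?_
    exact (Complex.measurable_ofReal.comp
      (measurable_spectralDensity n b).sqrt).aestronglyMeasurable
  rw [memLp_two_iff_integrable_sq_norm hmeas]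
  simp only [norm_whitened_sq]
  exact ((mem_kSpace_iff (pos_of_half_lt hb) (toFun_mem f).2.1).mp (toFun_mem f)).2

/-- The isometry `f ↦ f̂ / √p` of the native space into `L²`. -/
noncomputable def toL2 : KHilbert n b hn hb →ₗᵢ[ℂ] Lp ℂ 2 (volume : Measure (E n)) where
  toFun f := (memLp_whitened f).toLp (whitened f)
  map_add' f g := by
    rw [← MemLp.toLp_add]
    refine MemLp.toLp_congr _ _ ?_
    have h : (𝓕 ((toFun_mem (f + g)).2.1.toLp (KHilbert.toFun (f + g))) :
        Lp ℂ 2 (volume : Measure (E n))) =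
        𝓕 ((toFun_mem f).2.1.toLp (KHilbert.toFun f)) +
        𝓕 ((toFun_mem g).2.1.toLp (KHilbert.toFun g)) := by
      rw [← FourierAdd.fourier_add, ← MemLp.toLp_add]
      simp only [map_add]
    filter_upwards [Lp.coeFn_add (𝓕 ((toFun_mem f).2.1.toLp (KHilbert.toFun f)))
      (𝓕 ((toFun_mem g).2.1.toLp (KHilbert.toFun g)))] with w hw
    simp only [whitened, Pi.add_apply]
    rw [h, hw, Pi.add_apply, add_div]
  map_smul' c f := by
    rw [RingHom.id_apply, ← MemLp.toLp_const_smul]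
    refine MemLp.toLp_congr _ _ ?_
    have h : (𝓕 ((toFun_mem (c • f)).2.1.toLp (KHilbert.toFun (c • f))) :
        Lp ℂ 2 (volume : Measure (E n))) =
        c • 𝓕 ((toFun_mem f).2.1.toLp (KHilbert.toFun f)) := by
      rw [← FourierSMul.fourier_smul, ← MemLp.toLp_const_smul]
      simp only [map_smul]
    filter_upwards [Lp.coeFn_smul c (𝓕 ((toFun_mem f).2.1.toLp (KHilbert.toFun f)))] with w hw
    simp only [whitened, Pi.smul_apply]
    rw [h, hw, Pi.smul_apply, smul_div_assoc]
  norm_map' f := by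
    rw [← sq_eq_sq₀ (norm_nonneg _) (norm_nonneg _), norm_sq_eq f (toFun_mem f).2.1,
      ← Complex.ofReal_inj, Complex.ofReal_pow]
    refine (inner_self_eq_norm_sq_to_K (𝕜 := ℂ)
      ((memLp_whitened f).toLp (whitened f))).symm.trans ?_
    rw [L2.inner_def, ← integral_complex_ofReal]
    refine integral_congr_ae ?_
    filter_upwards [(memLp_whitened f).coeFn_toLp] with w hw
    rw [hw, inner_self_eq_norm_sq_to_K, ← norm_whitened_sq]
    norm_cast

/-- The preimage of `h` is the inverse transform of `h√p`. Integrability of `p` puts `h√p` in `L¹`,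
which gives continuity, and boundedness of `p` puts it in `L²`. -/
lemma toL2_surjective :
    Function.Surjective (toL2 : KHilbert n b hn hb →ₗᵢ[ℂ] Lp ℂ 2 (volume : Measure (E n))) := by
  intro h
  have hb0 := pos_of_half_lt hb
  set r : E n → ℂ := fun w => ((√(spectralDensity n b w) : ℝ) : ℂ) with hr
  have hrm : AEStronglyMeasurable r (volume : Measure (E n)) :=
    (Complex.measurable_ofReal.comp (measurable_spectralDensity n b).sqrt).aestronglyMeasurable
  have hrn : ∀ w, ‖r w‖ = √(spectralDensity n b w) := fun w => by
    rw [hr, Complex.norm_real, Real.norm_of_nonneg (Real.sqrt_nonneg _)]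
  have hr2 : MemLp r 2 (volume : Measure (E n)) := by
    rw [memLp_two_iff_integrable_sq_norm hrm]
    simp only [hrn, Real.sq_sqrt (spectralDensity_nonneg hb0 _)]
    exact integrable_spectralDensity hn hb
  have hu1 : Integrable fun w => h w * r w := (Lp.memLp h).integrable_mul hr2
  have hu2 : MemLp (fun w => h w * r w) 2 (volume : Measure (E n)) := by
    obtain ⟨M, hM⟩ := exists_spectralDensity_le hn hb
    refine (Lp.memLp h).of_le_mul (c := √M) hu1.aestronglyMeasurable ?_
    filter_upwards [hM] with w hw
    rw [norm_mul, hrn, mul_comm]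
    exact mul_le_mul_of_nonneg_right (Real.sqrt_le_sqrt hw) (norm_nonneg _)
  set f : E n → ℂ := 𝓕⁻ fun w => h w * r w with hf
  have hae := fourierInv_toLp_ae_eq hu1 hu2
  have hf2 : MemLp f 2 (volume : Measure (E n)) := (memLp_congr_ae hae).mp (Lp.memLp _)
  have hfu : 𝓕 (hf2.toLp f) = hu2.toLp _ := by
    have h1 : hf2.toLp f = 𝓕⁻ (hu2.toLp _) := Lp.ext (hf2.coeFn_toLp.trans hae.symm)
    rw [h1, FourierTransform.fourier_fourierInv_eq]
  have hw : ∀ᵐ w : E n, (𝓕 (hf2.toLp f) : Lp ℂ 2 (volume : Measure (E n))) w / r w = h w := by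
    filter_upwards [hu2.coeFn_toLp, ae_spectralDensity_pos hn hb0] with w h1 h2
    have h3 : r w ≠ 0 := Complex.ofReal_ne_zero.mpr (Real.sqrt_pos.mpr h2).ne'
    rw [hfu, h1, mul_div_cancel_right₀ _ h3]
  have hmem : f ∈ kSpace n (b - (n : ℝ) / 2) := by
    rw [mem_kSpace_iff hb0 hf2]
    refine ⟨continuous_fourierInv hu1, ?_⟩
    refine ((memLp_two_iff_integrable_sq_norm (Lp.aestronglyMeasurable h)).mp
      (Lp.memLp h)).congr ?_
    filter_upwards [hw] with w hw
    rw [← hw, norm_div, div_pow, hrn, Real.sq_sqrt (spectralDensity_nonneg hb0 w)]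
  refine ⟨⟨f, hmem⟩, ?_⟩
  refine Lp.ext ((memLp_whitened _).coeFn_toLp.trans ?_)
  exact hw

instance instCompleteSpace : CompleteSpace (KHilbert n b hn hb) :=
  (LinearIsometryEquiv.ofSurjective toL2 toL2_surjective).toIsometryEquiv.completeSpace

/-- The structure of a Hilbert space of functions on the native space. -/
noncomputable instance instRKHS : RKHS ℂ (KHilbert n b hn hb) (E n) ℂ where
  coeCLM := ContinuousLinearMap.pi fun y => innerSL ℂ (translate hn hb y)
  coeCLM_injective f g h := toFun_injective <| funext fun y => by
    rw [← inner_translate, ← inner_translate]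
    exact congrFun h y

lemma coeCLM_eq (f : KHilbert n b hn hb) : (RKHS.coeCLM ℂ f : E n → ℂ) = toFun f :=
  funext fun y => inner_translate y f

lemma hasReproducingKernel :
    HasReproducingKernel (KHilbert n b hn hb) fun x y : E n => invMultiquadric n b (x - y) := by
  intro x y
  have h : RKHS.kerFun (KHilbert n b hn hb) y (1 : ℂ) = translate hn hb y := by
    refine ext_inner_right ℂ fun f => ?_
    rw [RKHS.kerFun_inner, inner_translate, ← RKHS.coeCLM_apply, coeCLM_eq]
    simp
  rw [← RKHS.kerFun_apply, h, ← RKHS.coeCLM_apply, coeCLM_eq, toFun_translate]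

lemma norm_sum_smul_translate_sq (x : ℕ → E n) (s : Finset ℕ) (c : ℕ → ℂ) :
    ‖∑ j ∈ s, c j • translate hn hb (x j)‖ ^ 2 =
      ∑ j ∈ s, ∑ k ∈ s, (conj (c j) * c k).re * (1 + ‖x j - x k‖ ^ 2) ^ (-b) := by
  rw [← inner_self_eq_norm_sq (𝕜 := ℂ), sum_inner, map_sum]
  refine Finset.sum_congr rfl fun j _ => ?_
  rw [inner_sum, map_sum]
  refine Finset.sum_congr rfl fun k _ => ?_
  rw [inner_smul_left, inner_smul_right, inner_translate, toFun_translate, ← mul_assoc]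
  simp only [invMultiquadric, RCLike.re_to_complex, Complex.re_mul_ofReal]

lemma isRieszSequence_translate {x : ℕ → E n} (hx : 0 < separation x) :
    IsRieszSequence fun j => translate hn hb (x j) := by
  obtain ⟨a, ha, hl⟩ := exists_le_sum_sum_one_add_sq_rpow (pos_of_half_lt hb) hx
  obtain ⟨S, hu⟩ := exists_sum_sum_one_add_sq_rpow_le hb hx
  refine isRieszSequence_of_le_of_le ha (fun s c => ?_) (b := S) fun s c => ?_
  · rw [norm_sum_smul_translate_sq]
    exact hl s c
  · rw [norm_sum_smul_translate_sq]
    exact hu s c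

end KHilbert

end NativeSpace
end Multiquadric

theorem mainTheorem7 (n : ℕ) (hn : 0 < n) (β : ℝ) (hβ : (n : ℝ) / 2 < β) :
    -- the functions of the Hilbert space are those of `𝒦_{β-n/2}(ℝⁿ)`
    (Set.range (KHilbert.toFun : KHilbert n β hn hβ → E n → ℂ) = kSpace n (β - (n : ℝ) / 2)) ∧
    -- its inner product is the (absolutely convergent) integral
    (∀ f g : KHilbert n β hn hβ,
      Integrable (fun ξ : E n => l2Fourier (KHilbert.toFun f) ξ *
        conj (l2Fourier (KHilbert.toFun g) ξ) / (besselPotential n β ‖ξ‖ : ℂ)) ∧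
      ⟪g, f⟫_ℂ = ((((2 * Real.pi) ^ (2 * n))⁻¹ : ℝ) : ℂ) *
        ∫ ξ : E n, l2Fourier (KHilbert.toFun f) ξ *
          conj (l2Fourier (KHilbert.toFun g) ξ) / (besselPotential n β ‖ξ‖ : ℂ)) ∧
    -- it is a Hilbert space of functions with reproducing kernel `φ_β(x - y)`
    (∃ (_ : CompleteSpace (KHilbert n β hn hβ)) (_ : RKHS ℂ (KHilbert n β hn hβ) (E n) ℂ),
      (∀ f : KHilbert n β hn hβ,
        (RKHS.coeCLM ℂ f : E n → ℂ) = KHilbert.toFun f) ∧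
      HasReproducingKernel (KHilbert n β hn hβ) (fun x y : E n => invMultiquadric n β (x - y))) ∧
    -- and every Hilbert space of functions with that reproducing kernel coincides with it
    (∀ (H : Type*) [NormedAddCommGroup H] [InnerProductSpace ℂ H] [CompleteSpace H]
      [RKHS ℂ H (E n) ℂ],
      HasReproducingKernel H (fun x y : E n => invMultiquadric n β (x - y)) →
      ∃ e : H ≃ₗᵢ[ℂ] KHilbert n β hn hβ,
        ∀ h : H, KHilbert.toFun (e h) = (RKHS.coeCLM ℂ h : E n → ℂ)) ∧
    -- the translates form a Riesz sequence
    (∀ x : ℕ → E n, 0 < separation x →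
      (2 ≤ n ∨ (n = 1 ∧ 2 * ProbabilityTheory.beta (β - 1 / 2) (1 / 2) < separation x)) →
      ∃ τ : ℕ → KHilbert n β hn hβ,
        (∀ j, KHilbert.toFun (τ j) = fun y : E n => invMultiquadric n β (y - x j)) ∧
        IsRieszSequence τ) := by
  refine ⟨KHilbert.range_toFun, fun f g => ⟨?_, rfl⟩, ?_, ?_, ?_⟩
  · exact integrable_innerIntegrand (pos_of_half_lt hβ) (KHilbert.toFun_mem f)
      (KHilbert.toFun_mem g)
  · exact ⟨inferInstance, inferInstance, KHilbert.coeCLM_eq, KHilbert.hasReproducingKernel⟩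
  · intro H _ _ _ _ hH
    obtain ⟨e, he⟩ := exists_linearIsometryEquiv_of_kernel_eq hH
      (KHilbert.hasReproducingKernel (hn := hn) (hb := hβ))
    refine ⟨e, fun h => ?_⟩
    rw [← KHilbert.coeCLM_eq]
    exact funext (he h)
  · exact fun x hx _ => ⟨fun j => KHilbert.translate hn hβ (x j),
      fun j => KHilbert.toFun_translate (x j), KHilbert.isRieszSequence_translate hx⟩
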